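/- Let $f:\mathbb R\to\mathbb R$ be $C^\infty$ with $f''\ge\sigma>0$ on $\mathbb R$. For $\nu>0$ consider solutions $u(t,x)$, $t\ge 0$, of the unforced generalised Burgers equation $$u_t+f'(u)u_x-\nu u_{xx}=0,\qquad x\in S^1=\mathbb R/\mathbb Z,$$ which are continuous on $[0,\infty)\times S^1$ and $C^\infty$ for $t>0$, have zero space mean $\int_{S^1}u(t,x)\,dx=0$ for all $t\ge0$, and start from a Lipschitz initial value $u_0=u(0,\cdot)\not\equiv0$. Put $$D=\max\big(|u_0|_{L_1}^{-1},\,|u_0'|_{L_\infty}\big),\qquad \|v\|_s^2=(2\pi)^{2s}\sum_{k\in\mathbb Z}|k|^{2s}|\hat v(k)|^2 .$$ For every value of $D$ there is a constant $\tilde C>0$, depending only on $f$ and $D$, such that $\|u(t)\|_1^2\le\tilde C\nu^{-1}$ for all $t\ge0$, all $\nu\in(0,1]$ and all solutions $u$ as above with this value of $D$. Fix any such $\tilde C$, and let $\{A\}=\frac1{T_2-T_1}\int_{T_1}^{T_2}A(t)\,dt$ be the time average over $[T_1,T_2]$, where $$T_1=\tfrac14D^{-2}\tilde C^{-1},\qquad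 T_2=\max\big(\tfrac32T_1,\;2D\sigma^{-1}\big).$$ Then there is $\nu_0\in(0,1)$, depending only on $f$, $\sigma$, $D$ and $\tilde C$, such that for all $\nu\in(0,\nu_0]$ and all solutions $u$ as above with this value of $D$: - $\{\|u\|_s^2\}\sim 1$ for every $s\in(0,1/2)$; - $\{\|u\|_{1/2}^2\}\sim|\log\nu|$; - $\{\|u\|_s^2\}\sim\nu^{-(2s-1)}$ for every $s\in(1/2,1)$. Here $X\sim Y$ means $C^{-1}Y\le X\le CY$ with a constant $C>0$ that depends only on $s$, $f$, $\sigma$, $D$ and $\tilde C$; in particular $C$ does not depend on $\nu$ or on $u$. -/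

import Mathlib

open MeasureTheory Set

open scoped ContDiff

noncomputable section

/-- The `L_p` norm over the circle `ℝ/ℤ` of a `1`-periodic function `v : ℝ → ℝ`. -/
def circleLpNorm (p : ENNReal) (v : ℝ → ℝ) : ENNReal :=
  eLpNorm v p (volume.restrict (Ioc (0 : ℝ) 1))

/-- The squared homogeneous Sobolev norm `‖v‖_s² = (2π)^(2s) ∑_k |k|^(2s) |v̂(k)|²` of a
`1`-periodic function, with values in `[0, ∞]` (it is infinite when `v ∉ H^s`). -/
def sobolevNormSq (s : ℝ) (v : ℝ → ℝ) : ENNReal :=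
  ENNReal.ofReal ((2 * Real.pi) ^ (2 * s)) *
    ∑' k : ℤ, ENNReal.ofReal (|(k : ℝ)| ^ (2 * s) *
      ‖fourierCoeffOn (zero_lt_one : (0 : ℝ) < 1) (fun x => (v x : ℂ)) k‖ ^ 2)

/-- `u` is a solution on `t ≥ 0` of `u_t + f'(u) u_x - ν u_xx = 0` on the circle `ℝ/ℤ`, with zero
space mean and Lipschitz (that is, `W^{1,∞}`) initial value. It is continuous up to `t = 0`, and
`C^∞` for `t > 0`, as every classical solution is when `f` is `C^∞`.
Values of `u` at negative times are irrelevant. -/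
structure IsBurgersSolution (f : ℝ → ℝ) (ν : ℝ) (u : ℝ → ℝ → ℝ) : Prop where
  periodic : ∀ t, 0 ≤ t → Function.Periodic (u t) 1
  continuousOn : ContinuousOn (Function.uncurry u) (Ici (0 : ℝ) ×ˢ univ)
  smooth : ContDiffOn ℝ ∞ (Function.uncurry u) (Ioi (0 : ℝ) ×ˢ univ)
  lipschitz_initial : ∃ K, LipschitzWith K (u 0)
  zero_mean : ∀ t, 0 ≤ t → ∫ x in (0 : ℝ)..1, u t x = 0
  equation : ∀ t, 0 < t → ∀ x,
    deriv (fun τ => u τ x) t + deriv f (u t x) * deriv (u t) x - ν * deriv (deriv (u t)) x = 0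

/-- The quantity `D = max (|u₀|_1⁻¹, |u₀|_{1,∞})` in `[0, ∞]`; it is infinite when `u₀ = 0`. -/
def initialD (u₀ : ℝ → ℝ) : ENNReal :=
  max (circleLpNorm 1 u₀)⁻¹ (circleLpNorm ⊤ (deriv u₀))

/-- `Ct` is a positive constant, uniform in `ν ∈ (0, 1]` and in the initial values with the given
`D`, such that `‖u(t)‖_1² ≤ Ct ν⁻¹` for all `t ≥ 0`. -/
def IsH1Constant (f : ℝ → ℝ) (D Ct : ℝ) : Prop :=
  0 < Ct ∧ ∀ ν ∈ Ioc (0 : ℝ) 1, ∀ u : ℝ → ℝ → ℝ, IsBurgersSolution f ν u →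
    initialD (u 0) = ENNReal.ofReal D →
    ∀ t, 0 ≤ t → circleLpNorm 2 (deriv (u t)) ^ 2 ≤ ENNReal.ofReal (Ct * ν⁻¹)

/-- `T₁ = D⁻² Ct⁻¹ / 4`. -/
def startTime (D Ct : ℝ) : ℝ := 1 / 4 * (D ^ 2)⁻¹ * Ct⁻¹

/-- `T₂ = max (3 T₁ / 2, 2 D σ⁻¹)`. -/
def endTime (σ D Ct : ℝ) : ℝ := max (3 / 2 * startTime D Ct) (2 * D * σ⁻¹)

/-- The time average of `A` over `[T₁, T₂]`. -/
def timeAverage (T₁ T₂ : ℝ) (A : ℝ → ENNReal) : ENNReal :=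
  (∫⁻ t in Icc T₁ T₂, A t) / ENNReal.ofReal (T₂ - T₁)

/-- `C⁻¹ Y ≤ X ≤ C Y`. -/
def IsComparable (C : ℝ) (X : ENNReal) (Y : ℝ) : Prop :=
  ENNReal.ofReal (C⁻¹ * Y) ≤ X ∧ X ≤ ENNReal.ofReal (C * Y)

/-- With a constant `C > 0` that does not depend on `ν ∈ (0, ν₀]` nor on the solution `u` (given
its `D`), the average of `‖u‖_s²` over `[T₁, T₂]` satisfies `C⁻¹ Y(ν) ≤ {‖u‖_s²} ≤ C Y(ν)`. -/
def SobolevAverageSim (f : ℝ → ℝ) (σ D Ct ν₀ s : ℝ) (Y : ℝ → ℝ) : Prop :=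
  ∃ C : ℝ, 0 < C ∧ ∀ ν ∈ Ioc (0 : ℝ) ν₀, ∀ u : ℝ → ℝ → ℝ, IsBurgersSolution f ν u →
    initialD (u 0) = ENNReal.ofReal D →
    IsComparable C
      (timeAverage (startTime D Ct) (endTime σ D Ct) (fun t => sobolevNormSq s (u t))) (Y ν)

end

/-! ### Smoothness of slices -/

/-! The upper bounds come from a maximum principle, the lower bounds from a balance law for a
correlation function.

Comparing `u t (x + ξ) - u t x` with barriers in `ξ` (`two_point_le`) gives, for t > 0, `u_x ≤ D /
(1 + σ D t)`-type increments (`sub_le`) and `u_x ≥ -2DM/ν` (`sub_ge`), where `M` bounds `|f'|` on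
`[-D, D]`. Since `u_x` has mean zero and is at most `D`, it satisfies `∫ |u_x| ≤ 2D`; multiplying by
the sup bound gives `∫ u_x² ≤ 4D²M/ν`. On the Fourier side these read `|k|² |û(k)|² ≤ D²` and `∑
|k|² |û(k)|² ≲ 1/ν`. Using the first for `|k| ≤ N` and the second beyond, with `N ≈ 1/ν`, yields all
the upper bounds, at every positive time.

For the lower bounds, the energy loses at most `2 Ct` per unit time, so at `T₁` it is still at least
`D⁻²/2`, whereas the Oleinik decay forces it down to at most `D⁻²/4` by `T₂`. The correlation of `u`
with its integral over `[x, x + ℓ]` equals `ℓ` times the energy up to `O(ℓ²)`, so it drops by an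
amount of order `ℓ`. Its rate of decrease is at most `2M S(ℓ) + O(ν)`, with `S(ℓ) = ∫ |u(x + ℓ) -
u(x)|² dx`: after removing an exact difference, the nonlinear flux is a trapezoidal rule error,
which is quadratic in the increment. Hence the time integral of `S(ℓ)` is at least `c ℓ` for `K ν ≤
ℓ ≤ 1/n` (`integral_structureTwo_ge`, `exists_inertial_range`).

In Fourier variables `S(ℓ) ≲ ∑ min(1, (|k| ℓ)²) |û(k)|²`. For `s > 1/2` the single scale `ℓ = K ν`
gives the lower bound; for `s = 1/2` the scales `ℓ = 1/N` are summed and the harmonic sum produces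
the logarithm. For `s < 1/2` the energy remaining just after `T₁` is enough. -/

theorem contDiff_slice_right {g : ℝ → ℝ → ℝ}
    (hg : ContDiffOn ℝ ∞ (Function.uncurry g) (Ioi (0 : ℝ) ×ˢ univ)) {t : ℝ} (ht : 0 < t) :
    ContDiff ℝ ∞ (g t) := by
  rw [← contDiffOn_univ]
  have h2 : ContDiffOn ℝ ∞ (fun x : ℝ => ((t, x) : ℝ × ℝ)) univ := by fun_prop
  exact hg.comp h2 fun x _ => ⟨ht, mem_univ _⟩

theorem differentiableAt_slice_left {g : ℝ → ℝ → ℝ}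
    (hg : ContDiffOn ℝ ∞ (Function.uncurry g) (Ioi (0 : ℝ) ×ˢ univ)) {t : ℝ} (ht : 0 < t) (x : ℝ) :
    DifferentiableAt ℝ (fun τ => g τ x) t := by
  have h1 : ContDiffAt ℝ ∞ (Function.uncurry g) (t, x) :=
    hg.contDiffAt ((isOpen_Ioi.prod isOpen_univ).mem_nhds ⟨ht, mem_univ _⟩)
  have h2 : DifferentiableAt ℝ (fun τ : ℝ => ((τ, x) : ℝ × ℝ)) t := by fun_prop
  exact DifferentiableAt.comp t (h1.differentiableAt (by simp)) h2

theorem contDiffOn_deriv_right {g : ℝ → ℝ → ℝ}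
    (hg : ContDiffOn ℝ ∞ (Function.uncurry g) (Ioi (0 : ℝ) ×ˢ univ)) :
    ContDiffOn ℝ ∞ (Function.uncurry fun t => deriv (g t)) (Ioi (0 : ℝ) ×ˢ univ) := by
  have hS : IsOpen (Ioi (0 : ℝ) ×ˢ (univ : Set ℝ)) := isOpen_Ioi.prod isOpen_univ
  have h1 : ContDiffOn ℝ ∞ (fun p => fderiv ℝ (Function.uncurry g) p ((0, 1) : ℝ × ℝ))
      (Ioi (0 : ℝ) ×ˢ univ) :=
    (hg.fderiv_of_isOpen hS (by simp)).clm_apply contDiffOn_const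
  refine h1.congr fun p hp => ?_
  obtain ⟨t, x⟩ := p
  have h2 : DifferentiableAt ℝ (Function.uncurry g) (t, x) :=
    (hg.contDiffAt (hS.mem_nhds hp)).differentiableAt (by simp)
  have h3 : HasDerivAt (fun y : ℝ => ((t, y) : ℝ × ℝ)) (0, 1) x :=
    (hasDerivAt_const x t).prodMk (hasDerivAt_id x)
  exact (h2.hasFDerivAt.comp_hasDerivAt x h3).deriv

/-! ### Necessary conditions at a maximum -/

/-- A positive second derivative would make the point a local minimum as well, so `g` would be
locally constant and the second derivative would vanish. -/
theorem deriv_deriv_nonpos_of_isLocalMax {g : ℝ → ℝ} {a : ℝ} (hc : ContinuousAt g a)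
    (h : IsLocalMax g a) : deriv (deriv g) a ≤ 0 := by
  by_contra! hpos
  have hmin := isLocalMin_of_deriv_deriv_pos hpos h.deriv_eq_zero hc
  have hconst : g =ᶠ[nhds a] fun _ => g a := by
    filter_upwards [h, hmin] with x h1 h2 using le_antisymm h1 h2
  have h1 : deriv g =ᶠ[nhds a] fun _ => 0 := by
    filter_upwards [hconst.eventuallyEq_nhds] with x hx
    rw [hx.deriv_eq]; simp
  rw [h1.deriv_eq] at hpos
  simp at hpos

/-- Only earlier times are compared because the space-time maximum below may sit at the final time.
-/
theorem hasDerivAt_nonneg_of_le_left {g : ℝ → ℝ} {a b g' : ℝ} (hab : a < b)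
    (hg : HasDerivAt g g' b) (h : ∀ τ ∈ Ioc a b, g τ ≤ g b) : 0 ≤ g' := by
  by_contra! hneg
  have h1 := hg.tendsto_slope.eventually (gt_mem_nhds hneg)
  have h2 : ∀ᶠ y in nhdsWithin b (Iio b), slope g b y < 0 :=
    h1.filter_mono (nhdsWithin_mono b fun y hy => ne_of_lt hy)
  obtain ⟨y, hy1, hy2⟩ := (h2.and (Ioo_mem_nhdsLT hab)).exists
  rw [slope_def_field, div_neg_iff] at hy1
  have := h y ⟨hy2.1, hy2.2.le⟩
  rcases hy1 with h | h <;> linarith [hy2.2]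

/-! ### The two-point maximum principle -/

section Solution

variable {f : ℝ → ℝ} {ν : ℝ} {u : ℝ → ℝ → ℝ}

namespace IsBurgersSolution

theorem contDiff (hu : IsBurgersSolution f ν u) {t : ℝ} (ht : 0 < t) : ContDiff ℝ ∞ (u t) :=
  contDiff_slice_right hu.smooth ht

theorem continuous_slice (hu : IsBurgersSolution f ν u) {t : ℝ} (ht : 0 ≤ t) :
    Continuous (u t) := by
  rw [← continuousOn_univ]
  have h2 : ContinuousOn (fun x : ℝ => ((t, x) : ℝ × ℝ)) univ := by fun_prop
  exact hu.continuousOn.comp h2 fun x _ => ⟨ht, mem_univ _⟩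

theorem hasDerivAt_space (hu : IsBurgersSolution f ν u) {t : ℝ} (ht : 0 < t) (x : ℝ) :
    HasDerivAt (u t) (deriv (u t) x) x :=
  ((hu.contDiff ht).differentiable (by simp) x).hasDerivAt

theorem contDiff_deriv (hu : IsBurgersSolution f ν u) {t : ℝ} (ht : 0 < t) :
    ContDiff ℝ ∞ (deriv (u t)) :=
  contDiff_slice_right (contDiffOn_deriv_right hu.smooth) ht

theorem hasDerivAt_space_deriv (hu : IsBurgersSolution f ν u) {t : ℝ} (ht : 0 < t) (x : ℝ) :
    HasDerivAt (deriv (u t)) (deriv (deriv (u t)) x) x :=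
  ((hu.contDiff_deriv ht).differentiable (by simp) x).hasDerivAt

theorem hasDerivAt_time (hu : IsBurgersSolution f ν u) {t : ℝ} (ht : 0 < t) (x : ℝ) :
    HasDerivAt (fun τ => u τ x)
      (-(deriv f (u t x) * deriv (u t) x) + ν * deriv (deriv (u t)) x) t := by
  have h := (differentiableAt_slice_left hu.smooth ht x).hasDerivAt
  exact h.congr_deriv (by linarith [hu.equation t ht x])

/-- Suppose `e (u(t, x + ξ) - u(t, x)) - w(t, ξ)` has a positive maximum. The conditions at `ξ = 0`,
`ξ = 1` and `t = 0` make it interior in `ξ` and later than the initial time. Criticality in `x` and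
`ξ` gives `e u_x = w₁` at both endpoints. Moving the endpoints apart, `x - s` and `x + ξ + s`,
changes `ξ` by `2s`, so the second order condition reads `e (u_xx(x + ξ) - u_xx(x)) ≤ 4 w₂`; this is
the most favourable direction and the source of the factor 4. The equation then contradicts the sign
of the time derivative. The barrier inequality is needed only where the barrier is violated. -/
theorem two_point_le (hu : IsBurgersSolution f ν u) (hν : 0 ≤ ν) {e T : ℝ}
    {w wt w₁ w₂ : ℝ → ℝ → ℝ}
    (hwc : ContinuousOn (Function.uncurry w) (Ici (0 : ℝ) ×ˢ univ))
    (hwt : ∀ t, 0 < t → ∀ ξ, HasDerivAt (fun τ => w τ ξ) (wt t ξ) t)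
    (hw₁ : ∀ t, 0 < t → ∀ ξ, HasDerivAt (w t) (w₁ t ξ) ξ)
    (hw₂ : ∀ t, 0 < t → ∀ ξ, HasDerivAt (w₁ t) (w₂ t ξ) ξ)
    (hw0 : ∀ t, 0 ≤ t → 0 ≤ w t 0) (hw1 : ∀ t, 0 ≤ t → 0 ≤ w t 1)
    (hinit : ∀ x, ∀ ξ ∈ Icc (0 : ℝ) 1, e * (u 0 (x + ξ) - u 0 x) ≤ w 0 ξ)
    (hstrict : ∀ t, 0 < t → ∀ x, ∀ ξ ∈ Ioo (0 : ℝ) 1, w t ξ < e * (u t (x + ξ) - u t x) →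
      -(deriv f (u t (x + ξ)) - deriv f (u t x)) * w₁ t ξ + 4 * ν * w₂ t ξ - wt t ξ < 0)
    (hT : 0 ≤ T) (x ξ : ℝ) (hξ : ξ ∈ Icc (0 : ℝ) 1) :
    e * (u T (x + ξ) - u T x) ≤ w T ξ := by
  set Φ : ℝ × ℝ × ℝ → ℝ :=
    fun p => e * (u p.1 (p.2.1 + p.2.2) - u p.1 p.2.1) - w p.1 p.2.2 with hΦ
  have hΦc : ContinuousOn Φ (Icc 0 T ×ˢ Icc (0 : ℝ) 1 ×ˢ Icc (0 : ℝ) 1) := by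
    have h1 : ContinuousOn (fun p : ℝ × ℝ × ℝ => u p.1 (p.2.1 + p.2.2))
        (Icc 0 T ×ˢ Icc (0 : ℝ) 1 ×ˢ Icc (0 : ℝ) 1) :=
      hu.continuousOn.comp (f := fun p : ℝ × ℝ × ℝ => (p.1, p.2.1 + p.2.2)) (by fun_prop)
        fun p hp => ⟨hp.1.1, mem_univ _⟩
    have h2 : ContinuousOn (fun p : ℝ × ℝ × ℝ => u p.1 p.2.1)
        (Icc 0 T ×ˢ Icc (0 : ℝ) 1 ×ˢ Icc (0 : ℝ) 1) :=
      hu.continuousOn.comp (f := fun p : ℝ × ℝ × ℝ => (p.1, p.2.1)) (by fun_prop)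
        fun p hp => ⟨hp.1.1, mem_univ _⟩
    have h3 : ContinuousOn (fun p : ℝ × ℝ × ℝ => w p.1 p.2.2)
        (Icc 0 T ×ˢ Icc (0 : ℝ) 1 ×ˢ Icc (0 : ℝ) 1) :=
      hwc.comp (f := fun p : ℝ × ℝ × ℝ => (p.1, p.2.2)) (by fun_prop)
        fun p hp => ⟨hp.1.1, mem_univ _⟩
    exact (continuousOn_const.mul (h1.sub h2)).sub h3
  -- Periodicity turns a maximum over `x ∈ [0, 1]` into one over the whole line, so `x` has no
  -- boundary case.
  have hper : ∀ t, 0 ≤ t → ∀ x ξ, Φ (t, Int.fract x, ξ) = Φ (t, x, ξ) := by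
    intro t ht x ξ
    have h1 := fun y : ℝ => (hu.periodic t ht).sub_int_mul_eq (x := y) ⌊x⌋
    simp only [hΦ, Int.fract]
    rw [show x - (⌊x⌋ : ℝ) + ξ = x + ξ - (⌊x⌋ : ℝ) * 1 by ring,
      show x - (⌊x⌋ : ℝ) = x - (⌊x⌋ : ℝ) * 1 by ring, h1, h1]
  obtain ⟨⟨t₀, x₀, ξ₀⟩, ⟨ht₀, hx₀, hξ₀⟩, hmax'⟩ :=
    (isCompact_Icc.prod (isCompact_Icc.prod isCompact_Icc)).exists_isMaxOn
      ⟨((0 : ℝ), (0 : ℝ), (0 : ℝ)), ⟨⟨le_rfl, hT⟩, ⟨le_rfl, zero_le_one⟩, ⟨le_rfl, zero_le_one⟩⟩⟩ hΦc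
  have hmax : ∀ t ∈ Icc 0 T, ∀ x, ∀ ξ ∈ Icc (0 : ℝ) 1, Φ (t, x, ξ) ≤ Φ (t₀, x₀, ξ₀) := by
    intro t ht x ξ hξ
    rw [← hper t ht.1 x ξ]
    exact hmax' (a := (t, Int.fract x, ξ))
      ⟨ht, ⟨Int.fract_nonneg x, (Int.fract_lt_one x).le⟩, hξ⟩
  simp only at ht₀ hξ₀
  suffices hle : Φ (t₀, x₀, ξ₀) ≤ 0 by
    have := (hmax T ⟨hT, le_rfl⟩ x ξ hξ).trans hle
    simp only [hΦ] at this
    linarith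
  by_contra! hpos
  have hne0 : ξ₀ ≠ 0 := by
    rintro rfl
    have := hw0 t₀ ht₀.1
    simp only [hΦ, add_zero, sub_self, mul_zero] at hpos
    linarith
  have hne1 : ξ₀ ≠ 1 := by
    rintro rfl
    have := hw1 t₀ ht₀.1
    simp only [hΦ, hu.periodic t₀ ht₀.1 x₀, sub_self, mul_zero] at hpos
    linarith
  have hξI : ξ₀ ∈ Ioo (0 : ℝ) 1 :=
    ⟨lt_of_le_of_ne hξ₀.1 hne0.symm, lt_of_le_of_ne hξ₀.2 hne1⟩
  have htne : t₀ ≠ 0 := by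
    rintro rfl
    have := hinit x₀ ξ₀ hξ₀
    simp only [hΦ] at hpos
    linarith
  have htpos : 0 < t₀ := lt_of_le_of_ne ht₀.1 htne.symm
  -- first order conditions
  have hux := fun y => hu.hasDerivAt_space htpos y
  have huxx := fun y => hu.hasDerivAt_space_deriv htpos y
  have hX : e * (deriv (u t₀) (x₀ + ξ₀) - deriv (u t₀) x₀) = 0 := by
    have h1 : IsLocalMax (fun y => Φ (t₀, y, ξ₀)) x₀ :=
      Filter.Eventually.of_forall fun y => hmax t₀ ht₀ y ξ₀ hξ₀
    have h2 : HasDerivAt (fun y => Φ (t₀, y, ξ₀))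
        (e * (deriv (u t₀) (x₀ + ξ₀) - deriv (u t₀) x₀)) x₀ :=
      ((((hux (x₀ + ξ₀)).comp_add_const x₀ ξ₀).fun_sub (hux x₀)).const_mul e).sub_const (w t₀ ξ₀)
    exact h1.hasDerivAt_eq_zero h2
  have hnear : ∀ᶠ ξ in nhds ξ₀, ξ ∈ Icc (0 : ℝ) 1 := Icc_mem_nhds hξI.1 hξI.2
  have hΞ : e * deriv (u t₀) (x₀ + ξ₀) - w₁ t₀ ξ₀ = 0 := by
    have h1 : IsLocalMax (fun ξ => Φ (t₀, x₀, ξ)) ξ₀ := by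
      filter_upwards [hnear] with ξ hξ using hmax t₀ ht₀ x₀ ξ hξ
    have h2 : HasDerivAt (fun ξ => Φ (t₀, x₀, ξ))
        (e * deriv (u t₀) (x₀ + ξ₀) - w₁ t₀ ξ₀) ξ₀ :=
      ((((hux (x₀ + ξ₀)).comp_const_add x₀ ξ₀).sub_const (u t₀ x₀)).const_mul e).fun_sub (hw₁ t₀ htpos ξ₀)
    exact h1.hasDerivAt_eq_zero h2
  -- second order condition along the antidiagonal
  have hSS : e * (deriv (deriv (u t₀)) (x₀ + ξ₀) - deriv (deriv (u t₀)) x₀) - 4 * w₂ t₀ ξ₀ ≤ 0 := by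
    set g : ℝ → ℝ := fun s => e * (u t₀ (x₀ + ξ₀ + s) - u t₀ (x₀ - s)) - w t₀ (ξ₀ + 2 * s) with hg
    have hlin : ∀ s : ℝ, HasDerivAt (fun s : ℝ => ξ₀ + 2 * s) 2 s := fun s => by
      simpa using ((hasDerivAt_id s).const_mul (2 : ℝ)).const_add ξ₀
    have hg1 : ∀ s, HasDerivAt g (e * (deriv (u t₀) (x₀ + ξ₀ + s) + deriv (u t₀) (x₀ - s))
        - w₁ t₀ (ξ₀ + 2 * s) * 2) s := by
      intro s
      have h1 := (hux (x₀ + ξ₀ + s)).comp_const_add (x₀ + ξ₀) s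
      have h2 := (hux (x₀ - s)).comp_const_sub x₀ s
      have h3 : HasDerivAt (fun s => w t₀ (ξ₀ + 2 * s)) (w₁ t₀ (ξ₀ + 2 * s) * 2) s :=
        (hw₁ t₀ htpos (ξ₀ + 2 * s)).comp s (hlin s)
      exact (((h1.fun_sub h2).const_mul e).fun_sub h3).congr_deriv (by ring)
    have hg2 : HasDerivAt (deriv g) (e * (deriv (deriv (u t₀)) (x₀ + ξ₀ + 0) -
        deriv (deriv (u t₀)) (x₀ - 0)) - w₂ t₀ (ξ₀ + 2 * 0) * 2 * 2) 0 := by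
      have hd : deriv g = fun s => e * (deriv (u t₀) (x₀ + ξ₀ + s) + deriv (u t₀) (x₀ - s))
        - w₁ t₀ (ξ₀ + 2 * s) * 2 := funext fun s => (hg1 s).deriv
      rw [hd]
      have h1 := (huxx (x₀ + ξ₀ + 0)).comp_const_add (x₀ + ξ₀) 0
      have h2 := (huxx (x₀ - 0)).comp_const_sub x₀ 0
      have h3 : HasDerivAt (fun s => w₁ t₀ (ξ₀ + 2 * s)) (w₂ t₀ (ξ₀ + 2 * 0) * 2) 0 :=
        (hw₂ t₀ htpos (ξ₀ + 2 * 0)).comp 0 (hlin 0)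
      exact (((h1.fun_add h2).const_mul e).fun_sub (h3.mul_const 2)).congr_deriv (by ring)
    have hloc : IsLocalMax g 0 := by
      have hc : Filter.Tendsto (fun s : ℝ => ξ₀ + 2 * s) (nhds 0) (nhds ξ₀) := by
        have := (hlin 0).continuousAt.tendsto
        simpa using this
      filter_upwards [hc.eventually hnear] with s hs
      have := hmax t₀ ht₀ (x₀ - s) (ξ₀ + 2 * s) hs
      simp only [hΦ] at this
      simp only [hg, add_zero, sub_zero, mul_zero]
      rwa [show x₀ - s + (ξ₀ + 2 * s) = x₀ + ξ₀ + s by ring] at this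
    have := deriv_deriv_nonpos_of_isLocalMax (hg1 0).continuousAt hloc
    rw [hg2.deriv] at this
    simp only [add_zero, sub_zero, mul_zero] at this
    linarith
  -- time derivative
  have hTT := hasDerivAt_nonneg_of_le_left (g := fun τ => Φ (τ, x₀, ξ₀)) htpos
    ((((hu.hasDerivAt_time htpos (x₀ + ξ₀)).fun_sub (hu.hasDerivAt_time htpos x₀)).const_mul e).fun_sub
      (hwt t₀ htpos ξ₀)) fun τ hτ => hmax τ ⟨hτ.1.le, hτ.2.trans ht₀.2⟩ x₀ ξ₀ hξ₀
  have hS := hstrict t₀ htpos x₀ ξ₀ hξI (by simp only [hΦ] at hpos; linarith)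
  have hE : e * deriv (u t₀) x₀ = w₁ t₀ ξ₀ := by linarith
  have hE' : e * deriv (u t₀) (x₀ + ξ₀) = w₁ t₀ ξ₀ := by linarith
  have hν' := mul_le_mul_of_nonneg_left hSS hν
  have : e * ((-(deriv f (u t₀ (x₀ + ξ₀)) * deriv (u t₀) (x₀ + ξ₀)) +
      ν * deriv (deriv (u t₀)) (x₀ + ξ₀)) - (-(deriv f (u t₀ x₀) * deriv (u t₀) x₀) +
      ν * deriv (deriv (u t₀)) x₀)) - wt t₀ ξ₀ =
      -(deriv f (u t₀ (x₀ + ξ₀)) * (e * deriv (u t₀) (x₀ + ξ₀)) -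
        deriv f (u t₀ x₀) * (e * deriv (u t₀) x₀)) +
      ν * (e * (deriv (deriv (u t₀)) (x₀ + ξ₀) - deriv (deriv (u t₀)) x₀)) - wt t₀ ξ₀ := by ring
  rw [this, hE, hE'] at hTT
  linarith

end IsBurgersSolution

end Solution

/-! ### The initial value -/

theorem circleLpNorm_one_eq {v : ℝ → ℝ} (hv : Continuous v) :
    circleLpNorm 1 v = ENNReal.ofReal (∫ x in (0 : ℝ)..1, |v x|) := by
  rw [circleLpNorm, eLpNorm_one_eq_lintegral_enorm, intervalIntegral.integral_of_le zero_le_one,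
    ofReal_integral_eq_lintegral_ofReal (hv.abs.integrableOn_Ioc) (by filter_upwards with x; simp)]
  simp only [Real.enorm_eq_ofReal_abs]

theorem circleLpNorm_two_sq_eq {v : ℝ → ℝ} (hv : Continuous v) :
    circleLpNorm 2 v ^ 2 = ENNReal.ofReal (∫ x in (0 : ℝ)..1, v x ^ 2) := by
  have h := eLpNorm_nnreal_pow_eq_lintegral (μ := volume.restrict (Ioc (0 : ℝ) 1)) (f := v)
    (p := 2) (by norm_num)
  have h2 : circleLpNorm 2 v ^ 2 = ∫⁻ x in Ioc (0 : ℝ) 1, ‖v x‖ₑ ^ (2 : ℝ) := by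
    rw [circleLpNorm]
    simpa using h
  rw [h2, intervalIntegral.integral_of_le zero_le_one,
    ofReal_integral_eq_lintegral_ofReal
      (show Continuous fun x => v x ^ 2 by fun_prop).integrableOn_Ioc
      (by filter_upwards with x; positivity)]
  refine lintegral_congr fun x => ?_
  rw [Real.enorm_eq_ofReal_abs, ENNReal.ofReal_rpow_of_nonneg (abs_nonneg _) (by norm_num)]
  simp

theorem pos_of_initialD_eq {v : ℝ → ℝ} (hv : Continuous v) {D : ℝ}
    (h : initialD v = ENNReal.ofReal D) : 0 < D := by
  by_contra! hD
  rw [ENNReal.ofReal_of_nonpos hD] at h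
  have h1 : (circleLpNorm 1 v)⁻¹ ≤ 0 := h ▸ le_max_left _ _
  rw [nonpos_iff_eq_zero, ENNReal.inv_eq_zero, circleLpNorm_one_eq hv] at h1
  exact ENNReal.ofReal_ne_top h1

theorem inv_le_integral_abs_of_initialD_eq {v : ℝ → ℝ} (hv : Continuous v) {D : ℝ}
    (h : initialD v = ENNReal.ofReal D) : D⁻¹ ≤ ∫ x in (0 : ℝ)..1, |v x| := by
  have hD := pos_of_initialD_eq hv h
  have h1 : (circleLpNorm 1 v)⁻¹ ≤ ENNReal.ofReal D := h ▸ le_max_left _ _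
  rw [circleLpNorm_one_eq hv, ENNReal.inv_le_iff_inv_le, ← ENNReal.ofReal_inv_of_pos hD] at h1
  exact (ENNReal.ofReal_le_ofReal_iff
    (intervalIntegral.integral_nonneg zero_le_one fun x _ => abs_nonneg _)).1 h1

theorem sq_integral_abs_le {v : ℝ → ℝ} (hv : Continuous v) :
    (∫ x in (0 : ℝ)..1, |v x|) ^ 2 ≤ ∫ x in (0 : ℝ)..1, v x ^ 2 := by
  set m := ∫ x in (0 : ℝ)..1, |v x| with hm
  have h0 : 0 ≤ ∫ x in (0 : ℝ)..1, (|v x| - m) ^ 2 :=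
    intervalIntegral.integral_nonneg zero_le_one fun x _ => sq_nonneg _
  have h1 : ∀ x, (|v x| - m) ^ 2 = v x ^ 2 - 2 * m * |v x| + m ^ 2 := fun x => by
    rw [← sq_abs (v x)]; ring
  simp only [h1] at h0
  rw [intervalIntegral.integral_add, intervalIntegral.integral_sub,
    intervalIntegral.integral_const_mul, ← hm] at h0
  · simp only [intervalIntegral.integral_const, sub_zero, smul_eq_mul, one_mul] at h0
    nlinarith
  all_goals exact Continuous.intervalIntegrable (by fun_prop) _ _

theorem inv_sq_le_integral_sq_of_initialD_eq {v : ℝ → ℝ} (hv : Continuous v) {D : ℝ}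
    (h : initialD v = ENNReal.ofReal D) : (D ^ 2)⁻¹ ≤ ∫ x in (0 : ℝ)..1, v x ^ 2 := by
  have hD := pos_of_initialD_eq hv h
  refine le_trans ?_ (sq_integral_abs_le hv)
  rw [← inv_pow]
  exact pow_le_pow_left₀ (by positivity) (inv_le_integral_abs_of_initialD_eq hv h) 2

/-- `D` controls `deriv v` only almost everywhere on one period; absolute continuity of a Lipschitz
function converts this into a bound on increments. -/
theorem abs_sub_le_of_initialD_eq {v : ℝ → ℝ} {K : NNReal} (hv : LipschitzWith K v)
    (hper : Function.Periodic v 1) {D : ℝ} (h : initialD v = ENNReal.ofReal D) (x : ℝ) {ξ : ℝ}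
    (hξ : ξ ∈ Icc (0 : ℝ) 1) : |v (x + ξ) - v x| ≤ D * ξ := by
  have hD := pos_of_initialD_eq hv.continuous h
  have hae : ∀ᵐ y ∂(volume.restrict (Ioc (0 : ℝ) 1)), |deriv v y| ≤ D := by
    have h1 : circleLpNorm ⊤ (deriv v) ≤ ENNReal.ofReal D := h ▸ le_max_right _ _
    rw [circleLpNorm, eLpNorm_exponent_top] at h1
    filter_upwards [ae_le_eLpNormEssSup (f := deriv v) (μ := volume.restrict (Ioc (0 : ℝ) 1))]
      with y hy
    have h2 := hy.trans h1
    rw [Real.enorm_eq_ofReal_abs] at h2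
    exact (ENNReal.ofReal_le_ofReal_iff hD.le).1 h2
  have key : ∀ a b : ℝ, 0 ≤ a → a ≤ b → b ≤ 1 → |v b - v a| ≤ D * (b - a) := by
    intro a b ha hab hb
    rw [← ((hv.lipschitzOnWith (s := uIcc a b)).absolutelyContinuousOnInterval).integral_deriv_eq_sub]
    have h3 := intervalIntegral.norm_integral_le_of_norm_le_const_ae (a := a) (b := b)
      (f := deriv v) (C := D) (by
        rw [ae_restrict_iff' measurableSet_Ioc] at hae
        filter_upwards [hae] with y hy hy'
        rw [uIoc_of_le hab] at hy'
        exact hy ⟨ha.trans_lt hy'.1, hy'.2.trans hb⟩)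
    rwa [abs_of_nonneg (sub_nonneg.2 hab)] at h3
  have main : ∀ y, 0 ≤ y → y ≤ 1 → |v (y + ξ) - v y| ≤ D * ξ := by
    intro y hy0 hy1
    rcases le_total (y + ξ) 1 with h1 | h1
    · simpa using key y (y + ξ) hy0 (by linarith [hξ.1]) h1
    -- The interval crosses the end of the period: it is split there and its second piece is shifted
    -- back by one.
    · have e1 : v (y + ξ) = v (y + ξ - 1) := (hper.sub_eq _).symm
      have e2 : v 1 = v 0 := by simpa using hper 0
      have k1 := key 0 (y + ξ - 1) le_rfl (by linarith) (by linarith [hξ.2])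
      have k2 := key y 1 hy0 hy1 le_rfl
      rw [e1]
      calc |v (y + ξ - 1) - v y| = |(v (y + ξ - 1) - v 0) + (v 1 - v y)| := by rw [e2]; ring_nf
        _ ≤ _ := abs_add_le _ _
        _ ≤ D * ξ := by linarith
  have h1 := fun y : ℝ => hper.sub_int_mul_eq (x := y) ⌊x⌋
  have := main (Int.fract x) (Int.fract_nonneg x) (Int.fract_lt_one x).le
  simp only [Int.fract] at this
  rwa [show x - (⌊x⌋ : ℝ) + ξ = x + ξ - (⌊x⌋ : ℝ) * 1 by ring,
    show x - (⌊x⌋ : ℝ) = x - (⌊x⌋ : ℝ) * 1 by ring, h1, h1] at this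

/-! ### A priori bounds -/

/-- A solution with given `D`, together with the standing assumptions on `f`, `σ`, `ν`; `M` is a
bound for `f'` on `[-D, D]`. -/
structure IsAdmissible (f : ℝ → ℝ) (σ D M ν : ℝ) (u : ℝ → ℝ → ℝ) : Prop where
  smooth_flux : ContDiff ℝ ∞ f
  sigma_pos : 0 < σ
  convex : ∀ x : ℝ, σ ≤ deriv (deriv f) x
  bound : ∀ x ∈ Icc (-D) D, |deriv f x| ≤ M
  one_le_bound : 1 ≤ M
  nu_mem : ν ∈ Ioc (0 : ℝ) 1
  sol : IsBurgersSolution f ν u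
  initialD_eq : initialD (u 0) = ENNReal.ofReal D

theorem exists_bound_deriv {f : ℝ → ℝ} (hf : ContDiff ℝ ∞ f) (D : ℝ) :
    ∃ M : ℝ, 1 ≤ M ∧ ∀ x ∈ Icc (-D) D, |deriv f x| ≤ M := by
  obtain ⟨M, hM⟩ := isCompact_Icc.exists_bound_of_continuousOn (s := Icc (-D) D)
    (hf.continuous_deriv (by simp)).continuousOn
  exact ⟨max 1 M, le_max_left _ _, fun x hx => (hM x hx).trans (le_max_right _ _)⟩

namespace IsAdmissible

variable {f : ℝ → ℝ} {σ D M ν : ℝ} {u : ℝ → ℝ → ℝ}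

theorem nu_pos (h : IsAdmissible f σ D M ν u) : 0 < ν := h.nu_mem.1

theorem continuous_initial (h : IsAdmissible f σ D M ν u) : Continuous (u 0) :=
  h.sol.continuous_slice le_rfl

theorem D_pos (h : IsAdmissible f σ D M ν u) : 0 < D :=
  pos_of_initialD_eq h.continuous_initial h.initialD_eq

theorem initial_abs_sub_le (h : IsAdmissible f σ D M ν u) (x : ℝ) {ξ : ℝ}
    (hξ : ξ ∈ Icc (0 : ℝ) 1) : |u 0 (x + ξ) - u 0 x| ≤ D * ξ := by
  obtain ⟨K, hK⟩ := h.sol.lipschitz_initial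
  exact abs_sub_le_of_initialD_eq hK (h.sol.periodic 0 le_rfl) h.initialD_eq x hξ

theorem deriv_flux_sub_ge (h : IsAdmissible f σ D M ν u) {a b : ℝ} (hab : b ≤ a) :
    σ * (a - b) ≤ deriv f a - deriv f b := by
  have hd : Differentiable ℝ (deriv f) :=
    (contDiff_infty_iff_deriv.1 h.smooth_flux).2.differentiable (by simp)
  exact mul_sub_le_image_sub_of_le_deriv hd h.convex hab

/-- Oleinik's estimate. The slope `φ = D / (1 + σ D t)` solves `φ' = -σ φ²` with `φ(0) = D`, and
where `u(x + ξ) - u(x) > φ ξ` convexity makes the difference of `f'` exceed `σ φ ξ`, which is the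
strict inequality required of the barrier. -/
theorem sub_le (h : IsAdmissible f σ D M ν u) {t : ℝ} (ht : 0 ≤ t) (x : ℝ) {ξ : ℝ}
    (hξ : ξ ∈ Icc (0 : ℝ) 1) : u t (x + ξ) - u t x ≤ D / (1 + σ * D * t) * ξ := by
  have hD := h.D_pos
  have hσ := h.sigma_pos
  have hpos : ∀ t : ℝ, 0 ≤ t → 0 < 1 + σ * D * t := fun t ht => by positivity
  have := h.sol.two_point_le (e := 1) h.nu_pos.le (w := fun t ξ => D / (1 + σ * D * t) * ξ)
    (wt := fun t ξ => -(σ * D * D) / (1 + σ * D * t) ^ 2 * ξ)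
    (w₁ := fun t _ => D / (1 + σ * D * t)) (w₂ := fun _ _ => 0) ?_ ?_ ?_ ?_ ?_ ?_ ?_ ?_ ht x ξ hξ
  · simpa using this
  · refine ContinuousOn.mul (ContinuousOn.div (by fun_prop) (by fun_prop) ?_) (by fun_prop)
    intro p hp
    exact (hpos p.1 hp.1).ne'
  · intro t ht ξ
    have h1 : HasDerivAt (fun t : ℝ => 1 + σ * D * t) (σ * D) t := by
      simpa using ((hasDerivAt_id t).const_mul (σ * D)).const_add 1
    exact (((hasDerivAt_const t D).fun_div h1 (hpos t ht.le).ne').mul_const ξ).congr_deriv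
      (by ring)
  · intro t ht ξ
    simpa using (hasDerivAt_id ξ).const_mul (D / (1 + σ * D * t))
  · intro t ht ξ
    exact hasDerivAt_const _ _
  · intro t ht; simp
  · intro t ht
    have := hpos t ht
    positivity
  · intro x ξ hξ
    have := (le_abs_self _).trans (h.initial_abs_sub_le x hξ)
    simpa using this
  · intro t ht x ξ hξ hlt
    have hp := hpos t ht.le
    set φ := D / (1 + σ * D * t) with hφ
    have hφpos : 0 < φ := by positivity
    have h1 := h.deriv_flux_sub_ge (a := u t (x + ξ)) (b := u t x)
      (by nlinarith [mul_pos hφpos hξ.1])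
    have h2 : -(σ * D * D) / (1 + σ * D * t) ^ 2 * ξ = -(σ * φ * (φ * ξ)) := by
      rw [hφ]; field_simp
    rw [h2]
    have h3 : σ * (φ * ξ) < deriv f (u t (x + ξ)) - deriv f (u t x) := by
      refine lt_of_lt_of_le ?_ h1
      exact mul_lt_mul_of_pos_left (by linarith) hσ
    nlinarith [mul_lt_mul_of_pos_right h3 hφpos]

/-- By zero mean, `u t` vanishes somewhere in every unit interval; the one-sided increment bound
from a zero on the left bounds `u` above, and towards a zero on the right bounds it below. -/
theorem abs_le (h : IsAdmissible f σ D M ν u) {t : ℝ} (ht : 0 ≤ t) (x : ℝ) :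
    |u t x| ≤ D / (1 + σ * D * t) := by
  have hD := h.D_pos
  have hσ := h.sigma_pos
  have hφ : 0 < D / (1 + σ * D * t) := by positivity
  have hc := h.sol.continuous_slice ht
  have hzero : ∀ a : ℝ, ∃ c ∈ Icc a (a + 1), u t c = 0 := by
    intro a
    by_contra! hne
    have hint : ∫ y in a..(a + 1), u t y = 0 := by
      rw [(h.sol.periodic t ht).intervalIntegral_add_eq a 0, zero_add]
      exact h.sol.zero_mean t ht
    have hord := (isPreconnected_Icc (a := a) (b := a + 1)).image _ hc.continuousOn
    rcases lt_or_gt_of_ne (hne a ⟨le_rfl, by linarith⟩) with hneg | hpos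
    · have hall : ∀ y ∈ Icc a (a + 1), u t y < 0 := by
        intro y hy
        by_contra! hy0
        have : (0 : ℝ) ∈ u t '' Icc a (a + 1) :=
          hord.Icc_subset ⟨a, ⟨le_rfl, by linarith⟩, rfl⟩ ⟨y, hy, rfl⟩ ⟨hneg.le, hy0⟩
        obtain ⟨c, hc1, hc2⟩ := this
        exact hne c hc1 hc2
      have := intervalIntegral.intervalIntegral_pos_of_pos_on (f := fun y => -u t y) (a := a)
        (b := a + 1) (hc.neg.intervalIntegrable _ _)
        (fun y hy => by linarith [hall y (Ioo_subset_Icc_self hy)]) (by linarith)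
      rw [intervalIntegral.integral_neg, hint] at this
      simp at this
    · have hall : ∀ y ∈ Icc a (a + 1), 0 < u t y := by
        intro y hy
        by_contra! hy0
        have : (0 : ℝ) ∈ u t '' Icc a (a + 1) :=
          hord.Icc_subset ⟨y, hy, rfl⟩ ⟨a, ⟨le_rfl, by linarith⟩, rfl⟩ ⟨hy0, hpos.le⟩
        obtain ⟨c, hc1, hc2⟩ := this
        exact hne c hc1 hc2
      have := intervalIntegral.intervalIntegral_pos_of_pos_on (f := fun y => u t y) (a := a)
        (b := a + 1) (hc.intervalIntegrable _ _)
        (fun y hy => hall y (Ioo_subset_Icc_self hy)) (by linarith)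
      rw [hint] at this
      simp at this
  rw [_root_.abs_le]
  constructor
  · obtain ⟨c, hc1, hc2⟩ := hzero x
    have h1 := h.sub_le ht x (ξ := c - x) ⟨by linarith [hc1.1], by linarith [hc1.2]⟩
    rw [add_sub_cancel, hc2] at h1
    nlinarith [hc1.2]
  · obtain ⟨c, hc1, hc2⟩ := hzero (x - 1)
    have h1 := h.sub_le ht c (ξ := x - c) ⟨by linarith [hc1.2], by linarith [hc1.1]⟩
    rw [add_sub_cancel, hc2] at h1
    nlinarith [hc1.1]

theorem div_le_D (h : IsAdmissible f σ D M ν u) {t : ℝ} (ht : 0 ≤ t) :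
    D / (1 + σ * D * t) ≤ D := by
  have hD := h.D_pos
  have hσ := h.sigma_pos
  exact div_le_self hD.le (by nlinarith [mul_nonneg (mul_pos hσ hD).le ht])

theorem abs_le_D (h : IsAdmissible f σ D M ν u) {t : ℝ} (ht : 0 ≤ t) (x : ℝ) : |u t x| ≤ D :=
  (h.abs_le ht x).trans (h.div_le_D ht)

theorem sub_le_D (h : IsAdmissible f σ D M ν u) {t : ℝ} (ht : 0 ≤ t) (x : ℝ) {ξ : ℝ}
    (hξ : ξ ∈ Icc (0 : ℝ) 1) : u t (x + ξ) - u t x ≤ D * ξ :=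
  (h.sub_le ht x hξ).trans (mul_le_mul_of_nonneg_right (h.div_le_D ht) hξ.1)

/-- The barrier `2D (1 - exp(-κ ξ))` with `κ = M/ν` has `4ν w₂ = -4M w₁`, which beats the transport
term, at most `2M w₁`. Its slope at `ξ = 0` is `2DM/ν`. -/
theorem sub_ge (h : IsAdmissible f σ D M ν u) {t : ℝ} (ht : 0 ≤ t) (x : ℝ) {ξ : ℝ}
    (hξ : ξ ∈ Icc (0 : ℝ) 1) : -(2 * D * M / ν * ξ) ≤ u t (x + ξ) - u t x := by
  have hD := h.D_pos
  have hν := h.nu_pos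
  have hM := h.one_le_bound
  set κ := M / ν with hκ
  have hκpos : 0 < κ := by positivity
  have hκ1 : 1 ≤ κ := by rw [hκ, le_div_iff₀ hν]; linarith [h.nu_mem.2]
  have := h.sol.two_point_le (e := -1) hν.le (w := fun _ ξ => 2 * D * (1 - Real.exp (-κ * ξ)))
    (wt := fun _ _ => 0) (w₁ := fun _ ξ => 2 * D * (κ * Real.exp (-κ * ξ)))
    (w₂ := fun _ ξ => 2 * D * (-κ ^ 2 * Real.exp (-κ * ξ))) ?_ ?_ ?_ ?_ ?_ ?_ ?_ ?_ ht x ξ hξ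
  · have h1 := Real.add_one_le_exp (-κ * ξ)
    have h2 : 2 * D * M / ν * ξ = 2 * D * (κ * ξ) := by rw [hκ]; ring
    rw [h2]
    nlinarith
  · fun_prop
  · intro t ht ξ
    exact hasDerivAt_const _ _
  · intro t ht ξ
    have h1 : HasDerivAt (fun ξ : ℝ => Real.exp (-κ * ξ)) (Real.exp (-κ * ξ) * -κ) ξ := by
      simpa using ((hasDerivAt_id ξ).const_mul (-κ)).exp
    exact ((h1.const_sub 1).const_mul (2 * D)).congr_deriv (by ring)
  · intro t ht ξ
    have h1 : HasDerivAt (fun ξ : ℝ => Real.exp (-κ * ξ)) (Real.exp (-κ * ξ) * -κ) ξ := by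
      simpa using ((hasDerivAt_id ξ).const_mul (-κ)).exp
    exact ((h1.const_mul κ).const_mul (2 * D)).congr_deriv (by ring)
  · intro t ht; simp
  · intro t ht
    have : Real.exp (-κ * 1) ≤ 1 := Real.exp_le_one_iff.2 (by linarith)
    nlinarith
  · intro x ξ hξ
    have h1 := (neg_abs_le _).trans' (neg_le_neg (h.initial_abs_sub_le x hξ))
    have h2 : Real.exp (-κ * ξ) * (1 + ξ) ≤ 1 := by
      have h3 := Real.add_one_le_exp (κ * ξ)
      have h4 : Real.exp (-κ * ξ) * Real.exp (κ * ξ) = 1 := by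
        rw [← Real.exp_add]; simp
      have h5 : 1 + ξ ≤ Real.exp (κ * ξ) := by nlinarith [hξ.1]
      have := mul_le_mul_of_nonneg_left h5 (Real.exp_pos (-κ * ξ)).le
      linarith
    -- The factor 2 in the barrier is used here: `1 - exp(-κ ξ) ≥ ξ / (1 + ξ) ≥ ξ / 2` because `κ ≥
    -- 1` and `ξ ≤ 1`.
    have h6 : ξ ≤ 2 * (1 - Real.exp (-κ * ξ)) := by
      nlinarith [hξ.1, hξ.2, Real.exp_pos (-κ * ξ)]
    have := mul_le_mul_of_nonneg_left h6 hD.le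
    linarith
  · intro t ht x ξ hξ hlt
    have hb : ∀ y, |deriv f (u t y)| ≤ M := fun y =>
      h.bound _ (_root_.abs_le.1 (h.abs_le_D ht.le y))
    have h1 := _root_.abs_le.1 (hb x)
    have h2 := _root_.abs_le.1 (hb (x + ξ))
    have hE : 0 < 2 * D * (κ * Real.exp (-κ * ξ)) := by positivity
    have hk : ν * κ = M := by rw [hκ]; field_simp
    have e1 : 4 * ν * (2 * D * (-κ ^ 2 * Real.exp (-κ * ξ))) =
        -4 * M * (2 * D * (κ * Real.exp (-κ * ξ))) := by rw [← hk]; ring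
    rw [e1]
    nlinarith [mul_pos (show 0 < M by linarith) hE]

theorem deriv_le (h : IsAdmissible f σ D M ν u) {t : ℝ} (ht : 0 < t) (x : ℝ) :
    deriv (u t) x ≤ D := by
  have h1 := (h.sol.hasDerivAt_space ht x).tendsto_slope_zero_right
  refine le_of_tendsto h1 ?_
  filter_upwards [Ioo_mem_nhdsGT (zero_lt_one : (0 : ℝ) < 1)] with ξ hξ
  have h2 := h.sub_le_D ht.le x (Ioo_subset_Icc_self hξ)
  rw [smul_eq_mul, inv_mul_le_iff₀ hξ.1]
  linarith

theorem le_deriv (h : IsAdmissible f σ D M ν u) {t : ℝ} (ht : 0 < t) (x : ℝ) :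
    -(2 * D * M / ν) ≤ deriv (u t) x := by
  have h1 := (h.sol.hasDerivAt_space ht x).tendsto_slope_zero_right
  refine ge_of_tendsto h1 ?_
  filter_upwards [Ioo_mem_nhdsGT (zero_lt_one : (0 : ℝ) < 1)] with ξ hξ
  have h2 := h.sub_ge ht.le x (Ioo_subset_Icc_self hξ)
  rw [smul_eq_mul, le_inv_mul_iff₀ hξ.1]
  linarith

theorem abs_deriv_le (h : IsAdmissible f σ D M ν u) {t : ℝ} (ht : 0 < t) (x : ℝ) :
    |deriv (u t) x| ≤ 2 * D * M / ν := by
  refine _root_.abs_le.2 ⟨h.le_deriv ht x, (h.deriv_le ht x).trans ?_⟩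
  rw [le_div_iff₀ h.nu_pos]
  nlinarith [h.D_pos, h.one_le_bound, h.nu_mem.2, mul_le_mul_of_nonneg_left h.nu_mem.2 h.D_pos.le,
    mul_le_mul_of_nonneg_left h.one_le_bound h.D_pos.le]

theorem continuous_deriv (h : IsAdmissible f σ D M ν u) {t : ℝ} (ht : 0 < t) :
    Continuous (deriv (u t)) := (h.sol.contDiff_deriv ht).continuous

theorem integral_deriv_eq_zero (h : IsAdmissible f σ D M ν u) {t : ℝ} (ht : 0 < t) :
    ∫ x in (0 : ℝ)..1, deriv (u t) x = 0 := by
  rw [intervalIntegral.integral_eq_sub_of_hasDerivAt (fun x _ => h.sol.hasDerivAt_space ht x)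
    ((h.continuous_deriv ht).intervalIntegrable _ _)]
  have := h.sol.periodic t ht.le 0
  simp at this
  simp [this]

/-- A function bounded above by `D` satisfies `|y| ≤ 2D - y`, and `u_x` integrates to zero. -/
theorem integral_abs_deriv_le (h : IsAdmissible f σ D M ν u) {t : ℝ} (ht : 0 < t) :
    ∫ x in (0 : ℝ)..1, |deriv (u t) x| ≤ 2 * D := by
  have hc := h.continuous_deriv ht
  have h1 : ∫ x in (0 : ℝ)..1, |deriv (u t) x| ≤ ∫ x in (0 : ℝ)..1, (2 * D - deriv (u t) x) := by
    refine intervalIntegral.integral_mono_on zero_le_one (hc.abs.intervalIntegrable _ _)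
      ((continuous_const.sub hc).intervalIntegrable _ _) fun x _ => ?_
    rw [_root_.abs_le]
    constructor <;> linarith [h.deriv_le ht x, h.D_pos]
  rw [intervalIntegral.integral_sub (by simp) (hc.intervalIntegrable _ _),
    h.integral_deriv_eq_zero ht] at h1
  simpa using h1

theorem integral_sq_deriv_le (h : IsAdmissible f σ D M ν u) {t : ℝ} (ht : 0 < t) :
    ∫ x in (0 : ℝ)..1, deriv (u t) x ^ 2 ≤ 4 * D ^ 2 * M / ν := by
  have hc := h.continuous_deriv ht
  have h1 : ∫ x in (0 : ℝ)..1, deriv (u t) x ^ 2 ≤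
      ∫ x in (0 : ℝ)..1, 2 * D * M / ν * |deriv (u t) x| := by
    refine intervalIntegral.integral_mono_on zero_le_one ((hc.pow 2).intervalIntegrable _ _)
      ((continuous_const.mul hc.abs).intervalIntegrable _ _) fun x _ => ?_
    rw [← sq_abs, sq]
    exact mul_le_mul_of_nonneg_right (h.abs_deriv_le ht x) (abs_nonneg _)
  rw [intervalIntegral.integral_const_mul] at h1
  have h2 : 0 ≤ 2 * D * M / ν := (abs_nonneg _).trans (h.abs_deriv_le ht 0)
  refine h1.trans ((mul_le_mul_of_nonneg_left (h.integral_abs_deriv_le ht) h2).trans (le_of_eq ?_))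
  ring

theorem circleLpNorm_deriv_sq_le (h : IsAdmissible f σ D M ν u) {t : ℝ} (ht : 0 ≤ t) :
    circleLpNorm 2 (deriv (u t)) ^ 2 ≤ ENNReal.ofReal (4 * D ^ 2 * M * ν⁻¹) := by
  rcases ht.eq_or_lt with rfl | ht
  -- At `t = 0` there is no smoothness; the sup bound contained in `D` is used on a space of mass
  -- one.
  · have h1 : circleLpNorm 2 (deriv (u 0)) ≤ circleLpNorm ⊤ (deriv (u 0)) := by
      have : IsProbabilityMeasure (volume.restrict (Ioc (0 : ℝ) 1)) := ⟨by simp⟩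
      exact eLpNorm_le_eLpNorm_of_exponent_le le_top (measurable_deriv _).aestronglyMeasurable
    have h2 : circleLpNorm ⊤ (deriv (u 0)) ≤ ENNReal.ofReal D := h.initialD_eq ▸ le_max_right _ _
    calc circleLpNorm 2 (deriv (u 0)) ^ 2 ≤ ENNReal.ofReal D ^ 2 := by gcongr; exact h1.trans h2
      _ = ENNReal.ofReal (D ^ 2) := (ENNReal.ofReal_pow h.D_pos.le 2).symm
      _ ≤ _ := by
        refine ENNReal.ofReal_le_ofReal ?_
        have h3 : 1 ≤ ν⁻¹ := (one_le_inv₀ h.nu_pos).2 h.nu_mem.2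
        have h4 : 1 ≤ M * ν⁻¹ := one_le_mul_of_one_le_of_one_le h.one_le_bound h3
        nlinarith [sq_nonneg D, mul_le_mul_of_nonneg_left h4 (sq_nonneg D)]
  · rw [circleLpNorm_two_sq_eq (h.continuous_deriv ht), ← div_eq_mul_inv]
    exact ENNReal.ofReal_le_ofReal (h.integral_sq_deriv_le ht)

end IsAdmissible

theorem exists_isH1Constant {f : ℝ → ℝ} (hf : ContDiff ℝ ∞ f) {σ : ℝ} (hσ : 0 < σ)
    (hconv : ∀ x : ℝ, σ ≤ deriv (deriv f) x) (D : ℝ) : ∃ Ct : ℝ, IsH1Constant f D Ct := by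
  obtain ⟨M, hM1, hM⟩ := exists_bound_deriv hf D
  -- The `max` with 1 keeps the constant positive even when `D = 0`.
  refine ⟨max 1 (4 * D ^ 2 * M), by positivity, fun ν hν u hu hD t ht => ?_⟩
  refine (IsAdmissible.circleLpNorm_deriv_sq_le
    ⟨hf, hσ, hconv, hM, hM1, hν, hu, hD⟩ ht).trans (ENNReal.ofReal_le_ofReal ?_)
  exact mul_le_mul_of_nonneg_right (le_max_right _ _) (inv_nonneg.2 hν.1.le)

/-! ### Fourier coefficients -/

/-- The squared modulus `|v̂(k)|²` of the `k`-th Fourier coefficient of a `1`-periodic function. -/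
noncomputable def modeSq (v : ℝ → ℝ) (k : ℤ) : ℝ :=
  ‖fourierCoeffOn (zero_lt_one : (0 : ℝ) < 1) (fun x => (v x : ℂ)) k‖ ^ 2

theorem modeSq_nonneg (v : ℝ → ℝ) (k : ℤ) : 0 ≤ modeSq v k := sq_nonneg _

theorem fourierCoeffOn_unit_eq_integral (g : ℝ → ℂ) (k : ℤ) :
    fourierCoeffOn (zero_lt_one : (0 : ℝ) < 1) g k =
      ∫ x in (0 : ℝ)..1, Complex.exp (-(2 * Real.pi * k * x : ℝ) * Complex.I) * g x := by
  rw [fourierCoeffOn_eq_integral]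
  simp only [sub_zero, div_one, one_smul, smul_eq_mul]
  refine intervalIntegral.integral_congr fun x _ => ?_
  simp only [fourier_coe_apply]
  congr 2
  push_cast
  ring

theorem hasSum_modeSq {v : ℝ → ℝ} (hv : Continuous v) :
    HasSum (modeSq v) (∫ x in (0 : ℝ)..1, v x ^ 2) := by
  have hc : Continuous fun x => (v x : ℂ) := by fun_prop
  have hL2 : MemLp (fun x => (v x : ℂ)) 2 (volume.restrict (Ioc (0 : ℝ) 1)) :=
    (memLp_two_iff_integrable_sq_norm hc.aestronglyMeasurable).2
      ((show Continuous fun x => ‖(v x : ℂ)‖ ^ 2 by fun_prop).integrableOn_Ioc)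
  change HasSum (fun k => modeSq v k) _
  simpa [modeSq] using hasSum_sq_fourierCoeffOn (zero_lt_one : (0 : ℝ) < 1) hL2

theorem modeSq_zero {v : ℝ → ℝ} (hv : ∫ x in (0 : ℝ)..1, v x = 0) : modeSq v 0 = 0 := by
  have h : ∫ x in (0 : ℝ)..1, (v x : ℂ) = 0 := by
    rw [intervalIntegral.integral_ofReal, hv]; simp
  simp [modeSq, fourierCoeffOn_unit_eq_integral, h]

theorem modeSq_le_sq_integral_abs (v : ℝ → ℝ) (k : ℤ) :
    modeSq v k ≤ (∫ x in (0 : ℝ)..1, |v x|) ^ 2 := by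
  refine pow_le_pow_left₀ (norm_nonneg _) ?_ 2
  rw [fourierCoeffOn_unit_eq_integral]
  refine (intervalIntegral.norm_integral_le_integral_norm zero_le_one).trans (le_of_eq ?_)
  refine intervalIntegral.integral_congr fun x _ => ?_
  simp only [norm_mul, ← Complex.ofReal_neg, Complex.norm_exp_ofReal_mul_I, one_mul,
    Complex.norm_real, Real.norm_eq_abs]

theorem modeSq_deriv {v v' : ℝ → ℝ} (hv : ∀ x, HasDerivAt v (v' x) x) (hv' : Continuous v')
    (hper : Function.Periodic v 1) (k : ℤ) :
    modeSq v' k = (2 * Real.pi) ^ 2 * (|(k : ℝ)| ^ 2 * modeSq v k) := by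
  have hd : ∀ x : ℝ, HasDerivAt (fun x => (v x : ℂ)) (v' x : ℂ) x := fun x => (hv x).ofReal_comp
  have hc : Continuous fun x => (v' x : ℂ) := by fun_prop
  have h01 : v 1 = v 0 := by simpa using hper 0
  rcases eq_or_ne k 0 with rfl | hk
  · have : ∫ x in (0 : ℝ)..1, v' x = 0 := by
      rw [intervalIntegral.integral_eq_sub_of_hasDerivAt (fun x _ => hv x)
        (hv'.intervalIntegrable _ _), h01, sub_self]
    simp [modeSq_zero this]
  · have h := fourierCoeffOn_of_hasDerivAt (zero_lt_one : (0 : ℝ) < 1) hk (fun x _ => hd x)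
      (hc.intervalIntegrable _ _)
    have hk' : (|(k : ℝ)|) ≠ 0 := by simpa using hk
    simp only [modeSq, h, h01, sub_self, mul_zero, zero_sub]
    simp only [norm_mul, norm_div, norm_neg, norm_one, Complex.norm_I, Complex.norm_ofNat,
      Complex.norm_real, Complex.norm_intCast, Real.norm_eq_abs, abs_of_pos Real.pi_pos, mul_one]
    norm_num
    field_simp
    rw [sq_abs]

/-- Translation by `h` multiplies the `k`-th coefficient by `exp(iθ)` with `θ = 2πkh`, and `|exp(iθ)
- 1| ≤ min(2, |θ|)`. -/
theorem modeSq_sub_translate_le {v : ℝ → ℝ} (hv : Continuous v) (hper : Function.Periodic v 1)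
    (h : ℝ) (k : ℤ) :
    modeSq (fun x => v (x + h) - v x) k ≤
      4 * Real.pi ^ 2 * min 1 ((|(k : ℝ)| * h) ^ 2) * modeSq v k := by
  set e : ℝ → ℂ := fun x => Complex.exp (-(2 * Real.pi * k * x : ℝ) * Complex.I) with he
  have hec : Continuous e := by fun_prop
  set θ : ℝ := 2 * Real.pi * k * h with hθ
  have htr : ∫ x in (0 : ℝ)..1, e x * (v (x + h) : ℂ) =
      Complex.exp (Complex.I * θ) * ∫ x in (0 : ℝ)..1, e x * (v x : ℂ) := by
    have hp : Function.Periodic (fun x => e x * (v x : ℂ)) 1 := by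
      intro x
      have h1 : e (x + 1) = e x := by
        simp only [he]
        rw [Complex.exp_eq_exp_iff_exists_int]
        exact ⟨-k, by push_cast; ring⟩
      simp only [h1, hper x]
    have h2 : ∀ x, e x * (v (x + h) : ℂ) =
        Complex.exp (Complex.I * θ) * (e (x + h) * (v (x + h) : ℂ)) := by
      intro x
      rw [← mul_assoc]
      congr 1
      simp only [he, ← Complex.exp_add, hθ]
      congr 1
      push_cast
      ring
    simp only [h2]
    rw [intervalIntegral.integral_const_mul,
      intervalIntegral.integral_comp_add_right (fun x => e x * (v x : ℂ)), zero_add, add_comm 1 h,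
      hp.intervalIntegral_add_eq h 0, zero_add]
  have hco : fourierCoeffOn (zero_lt_one : (0 : ℝ) < 1) (fun x => ((v (x + h) - v x : ℝ) : ℂ)) k =
      (Complex.exp (Complex.I * θ) - 1) *
        fourierCoeffOn (zero_lt_one : (0 : ℝ) < 1) (fun x => (v x : ℂ)) k := by
    rw [fourierCoeffOn_unit_eq_integral, fourierCoeffOn_unit_eq_integral, sub_mul, one_mul, ← htr,
      ← intervalIntegral.integral_sub]
    · refine intervalIntegral.integral_congr fun x _ => ?_
      simp only [he]
      push_cast
      ring
    all_goals exact Continuous.intervalIntegrable (by fun_prop) _ _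
  rw [modeSq, hco, norm_mul, mul_pow]
  refine mul_le_mul_of_nonneg_right ?_ (sq_nonneg _)
  have hn1 : ‖Complex.exp (Complex.I * θ) - 1‖ ≤ |θ| := by
    simpa using Real.norm_exp_I_mul_ofReal_sub_one_le (x := θ)
  have hn2 : ‖Complex.exp (Complex.I * θ) - 1‖ ≤ 2 := by
    refine (norm_sub_le _ _).trans ?_
    rw [mul_comm, Complex.norm_exp_ofReal_mul_I]
    norm_num
  have hpi : 1 ≤ Real.pi := by linarith [Real.pi_gt_three]
  have hb1 : ‖Complex.exp (Complex.I * θ) - 1‖ ^ 2 ≤ 4 * Real.pi ^ 2 * (|(k : ℝ)| * h) ^ 2 := by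
    refine (pow_le_pow_left₀ (norm_nonneg _) hn1 2).trans (le_of_eq ?_)
    rw [sq_abs, mul_pow |(k : ℝ)|, sq_abs, hθ]
    ring
  have hb2 : ‖Complex.exp (Complex.I * θ) - 1‖ ^ 2 ≤ 4 * Real.pi ^ 2 * 1 := by
    refine (pow_le_pow_left₀ (norm_nonneg _) hn2 2).trans ?_
    nlinarith
  rcases min_choice 1 ((|(k : ℝ)| * h) ^ 2) with hm | hm <;> rw [hm] <;> assumption

/-! ### Lower bounds for Sobolev norms -/

/-- The second order structure function `∫ |v(x + h) - v(x)|² dx`. -/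
noncomputable def structureTwo (v : ℝ → ℝ) (h : ℝ) : ℝ :=
  ∫ x in (0 : ℝ)..1, (v (x + h) - v x) ^ 2

theorem structureTwo_nonneg (v : ℝ → ℝ) (h : ℝ) : 0 ≤ structureTwo v h :=
  intervalIntegral.integral_nonneg zero_le_one fun _ _ => sq_nonneg _

theorem tsum_le_sobolevNormSq {s : ℝ} (hs : 0 ≤ s) (v : ℝ → ℝ) :
    ∑' k : ℤ, ENNReal.ofReal (|(k : ℝ)| ^ (2 * s) * modeSq v k) ≤ sobolevNormSq s v := by
  have h1 : 1 ≤ ENNReal.ofReal ((2 * Real.pi) ^ (2 * s)) := by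
    rw [ENNReal.one_le_ofReal]
    exact Real.one_le_rpow (by linarith [Real.pi_gt_three]) (by linarith)
  calc _ = 1 * ∑' k : ℤ, ENNReal.ofReal (|(k : ℝ)| ^ (2 * s) * modeSq v k) := (one_mul _).symm
    _ ≤ _ := mul_le_mul_left h1 _

theorem ofReal_integral_sq_eq_tsum {v : ℝ → ℝ} (hv : Continuous v) :
    ENNReal.ofReal (∫ x in (0 : ℝ)..1, v x ^ 2) = ∑' k : ℤ, ENNReal.ofReal (modeSq v k) := by
  rw [← (hasSum_modeSq hv).tsum_eq,
    ENNReal.ofReal_tsum_of_nonneg (modeSq_nonneg v) (hasSum_modeSq hv).summable]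

theorem integral_sq_le_sobolevNormSq {s : ℝ} (hs : 0 ≤ s) {v : ℝ → ℝ} (hv : Continuous v)
    (hmean : ∫ x in (0 : ℝ)..1, v x = 0) :
    ENNReal.ofReal (∫ x in (0 : ℝ)..1, v x ^ 2) ≤ sobolevNormSq s v := by
  refine le_trans ?_ (tsum_le_sobolevNormSq hs v)
  rw [ofReal_integral_sq_eq_tsum hv]
  refine ENNReal.tsum_le_tsum fun k => ENNReal.ofReal_le_ofReal ?_
  rcases eq_or_ne k 0 with rfl | hk
  · simp [modeSq_zero hmean]
  · have h1 : (1 : ℝ) ≤ |(k : ℝ)| := by exact_mod_cast Int.one_le_abs hk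
    exact le_mul_of_one_le_left (modeSq_nonneg v k) (Real.one_le_rpow h1 (by linarith))

theorem structureTwo_le_tsum {v : ℝ → ℝ} (hv : Continuous v) (hper : Function.Periodic v 1)
    (h : ℝ) : ENNReal.ofReal (structureTwo v h) ≤
      ∑' k : ℤ, ENNReal.ofReal (4 * Real.pi ^ 2 * min 1 ((|(k : ℝ)| * h) ^ 2) * modeSq v k) := by
  rw [structureTwo, ofReal_integral_sq_eq_tsum (v := fun x => v (x + h) - v x) (by fun_prop)]
  exact ENNReal.tsum_le_tsum fun k =>
    ENNReal.ofReal_le_ofReal (modeSq_sub_translate_le hv hper h k)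

theorem min_one_sq_le_rpow {s z : ℝ} (hs0 : 0 ≤ s) (hs1 : s ≤ 1) (hz : 0 ≤ z) :
    min 1 (z ^ 2) ≤ z ^ (2 * s) := by
  rcases le_total z 1 with h1 | h1
  · refine (min_le_right _ _).trans ?_
    rcases hz.eq_or_lt with rfl | hz
    · rw [zero_pow two_ne_zero]; positivity
    · rw [← Real.rpow_two]
      exact Real.rpow_le_rpow_of_exponent_ge hz h1 (by linarith)
  · exact (min_le_left _ _).trans (Real.one_le_rpow h1 (by linarith))

theorem structureTwo_le_sobolevNormSq {s : ℝ} (hs0 : 0 ≤ s) (hs1 : s ≤ 1) {v : ℝ → ℝ}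
    (hv : Continuous v) (hper : Function.Periodic v 1) {h : ℝ} (hh : 0 ≤ h) :
    ENNReal.ofReal (structureTwo v h) ≤
      ENNReal.ofReal (4 * Real.pi ^ 2 * h ^ (2 * s)) * sobolevNormSq s v := by
  refine (structureTwo_le_tsum hv hper h).trans ?_
  refine le_trans ?_ (mul_le_mul_right (tsum_le_sobolevNormSq hs0 v) _)
  rw [← ENNReal.tsum_mul_left]
  refine ENNReal.tsum_le_tsum fun k => ?_
  rw [← ENNReal.ofReal_mul (by positivity)]
  refine ENNReal.ofReal_le_ofReal ?_
  have h1 := min_one_sq_le_rpow hs0 hs1 (z := |(k : ℝ)| * h) (by positivity)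
  rw [Real.mul_rpow (abs_nonneg _) hh] at h1
  calc _ ≤ 4 * Real.pi ^ 2 * (|(k : ℝ)| ^ (2 * s) * h ^ (2 * s)) * modeSq v k := by
        gcongr
        exact modeSq_nonneg v k
    _ = _ := by ring

/-- The terms with `N ≤ m` contribute at most `m`, and so does the tail `m² ∑_{N > m} N⁻²`. -/
theorem sum_min_one_sq_le (m a b : ℕ) (ha : 1 ≤ a) :
    ∑ N ∈ Finset.Icc a b, min 1 (((m : ℝ) * (N : ℝ)⁻¹) ^ 2) ≤ 2 * (m : ℝ) := by
  rcases Nat.eq_zero_or_pos m with rfl | hm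
  · simp
  have hm' : (0 : ℝ) < m := by exact_mod_cast hm
  have hsub : Finset.Icc a b ⊆ Finset.Ioc 0 m ∪ Finset.Ioc m (max m b) := by
    intro N hN
    simp only [Finset.mem_Icc, Finset.mem_union, Finset.mem_Ioc] at hN ⊢
    rcases le_or_gt N m with h | h
    · left; omega
    · right; exact ⟨h, hN.2.trans (le_max_right _ _)⟩
  have hnn : ∀ N : ℕ, 0 ≤ min 1 (((m : ℝ) * (N : ℝ)⁻¹) ^ 2) := fun N => by positivity
  have hdis : Disjoint (Finset.Ioc 0 m) (Finset.Ioc m (max m b)) := by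
    rw [Finset.disjoint_left]
    intro N h1 h2
    simp only [Finset.mem_Ioc] at h1 h2
    omega
  calc _ ≤ ∑ N ∈ Finset.Ioc 0 m ∪ Finset.Ioc m (max m b), min 1 (((m : ℝ) * (N : ℝ)⁻¹) ^ 2) :=
        Finset.sum_le_sum_of_subset_of_nonneg hsub fun N _ _ => hnn N
    _ = ∑ N ∈ Finset.Ioc 0 m, min 1 (((m : ℝ) * (N : ℝ)⁻¹) ^ 2) +
        ∑ N ∈ Finset.Ioc m (max m b), min 1 (((m : ℝ) * (N : ℝ)⁻¹) ^ 2) :=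
        Finset.sum_union hdis
    _ ≤ ∑ N ∈ Finset.Ioc 0 m, (1 : ℝ) +
        ∑ N ∈ Finset.Ioc m (max m b), (m : ℝ) ^ 2 * ((N : ℝ) ^ 2)⁻¹ := by
        gcongr with N hN N hN
        · exact min_le_left _ _
        · exact (min_le_right _ _).trans (le_of_eq (by rw [mul_pow, inv_pow]))
    _ ≤ m + (m : ℝ) ^ 2 * (m : ℝ)⁻¹ := by
        rw [← Finset.mul_sum]
        gcongr
        · simp
        · refine (sum_Ioc_inv_sq_le_sub hm.ne' (le_max_left m b)).trans ?_
          have : (0 : ℝ) ≤ ((max m b : ℕ) : ℝ)⁻¹ := by positivity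
          linarith
    _ = _ := by field_simp; norm_num

/-- The sum over scales `1/N` is a discrete form of `∫ S(h) h⁻² dh`, which is comparable to the
squared `H^{1/2}` norm. A single scale would lose the logarithm. -/
theorem sum_structureTwo_le_sobolevNormSq {v : ℝ → ℝ} (hv : Continuous v)
    (hper : Function.Periodic v 1) {a : ℕ} (ha : 1 ≤ a) (b : ℕ) :
    ENNReal.ofReal (∑ N ∈ Finset.Icc a b, structureTwo v (N : ℝ)⁻¹) ≤
      ENNReal.ofReal (8 * Real.pi ^ 2) * sobolevNormSq (1 / 2) v := by
  rw [ENNReal.ofReal_sum_of_nonneg fun N _ => structureTwo_nonneg v _]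
  refine (Finset.sum_le_sum fun N _ => structureTwo_le_tsum hv hper _).trans ?_
  rw [← Summable.tsum_finsetSum fun N _ => ENNReal.summable]
  refine le_trans ?_ (mul_le_mul_right (tsum_le_sobolevNormSq (by norm_num) v) _)
  rw [← ENNReal.tsum_mul_left]
  refine ENNReal.tsum_le_tsum fun k => ?_
  rw [← ENNReal.ofReal_mul (by positivity), ← ENNReal.ofReal_sum_of_nonneg fun N _ => by
    have := modeSq_nonneg v k
    positivity]
  refine ENNReal.ofReal_le_ofReal ?_
  have h1 := sum_min_one_sq_le k.natAbs a b ha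
  rw [Nat.cast_natAbs, Int.cast_abs] at h1
  rw [← Finset.sum_mul, ← Finset.mul_sum, show (2 : ℝ) * (1 / 2) = 1 by norm_num, Real.rpow_one]
  calc _ ≤ 4 * Real.pi ^ 2 * (2 * |(k : ℝ)|) * modeSq v k := by
        gcongr
        exact modeSq_nonneg v k
    _ = _ := by ring

/-! ### Upper bounds for Sobolev norms -/

theorem sobolevNormSq_le_of_tsum_le {s T : ℝ} {v : ℝ → ℝ}
    (h : ∑' k : ℤ, ENNReal.ofReal (|(k : ℝ)| ^ (2 * s) * modeSq v k) ≤ ENNReal.ofReal T) :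
    sobolevNormSq s v ≤ ENNReal.ofReal ((2 * Real.pi) ^ (2 * s) * T) := by
  rw [ENNReal.ofReal_mul (by positivity)]
  exact mul_le_mul_right h _

theorem rpow_mul_le_of_sq_mul_le {v : ℝ → ℝ} {A s : ℝ} {k : ℤ} (hk : k ≠ 0)
    (hA : |(k : ℝ)| ^ 2 * modeSq v k ≤ A) :
    |(k : ℝ)| ^ (2 * s) * modeSq v k ≤ A * |(k : ℝ)| ^ (2 * s - 2) := by
  have hk' : 0 < |(k : ℝ)| := by simpa using hk
  have h1 : |(k : ℝ)| ^ (2 * s) = |(k : ℝ)| ^ (2 * s - 2) * |(k : ℝ)| ^ 2 := by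
    rw [← Real.rpow_natCast, ← Real.rpow_add hk']
    congr 1
    push_cast
    ring
  rw [h1, mul_assoc, mul_comm A]
  exact mul_le_mul_of_nonneg_left hA (by positivity)

theorem sobolevNormSq_le_of_lt_half {v : ℝ → ℝ} {A s : ℝ} (hs0 : 0 < s) (hs : s < 1 / 2)
    (hA0 : 0 ≤ A) (hA : ∀ k : ℤ, |(k : ℝ)| ^ 2 * modeSq v k ≤ A) :
    sobolevNormSq s v ≤ ENNReal.ofReal
      ((2 * Real.pi) ^ (2 * s) * (A * ∑' k : ℤ, |(k : ℝ)| ^ (-(2 - 2 * s)))) := by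
  refine sobolevNormSq_le_of_tsum_le ?_
  have hsum : Summable fun k : ℤ => |(k : ℝ)| ^ (-(2 - 2 * s)) :=
    Real.summable_abs_int_rpow (by linarith)
  rw [← tsum_mul_left, ENNReal.ofReal_tsum_of_nonneg (fun k => by positivity) (hsum.mul_left A)]
  refine ENNReal.tsum_le_tsum fun k => ENNReal.ofReal_le_ofReal ?_
  rcases eq_or_ne k 0 with rfl | hk
  · rw [Int.cast_zero, abs_zero, Real.zero_rpow (by linarith), zero_mul]
    positivity
  · rw [neg_sub]
    exact rpow_mul_le_of_sq_mul_le hk (hA k)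

theorem sum_Icc_neg_abs_le {g : ℝ → ℝ} (n : ℕ) :
    ∑ k ∈ Finset.Icc (-(n : ℤ)) n, g |(k : ℝ)| = g 0 + 2 * ∑ j ∈ Finset.Icc 1 n, g (j : ℝ) := by
  induction n with
  | zero => simp
  | succ n ih =>
    have h1 : Finset.Icc (-((n + 1 : ℕ) : ℤ)) ((n + 1 : ℕ) : ℤ) =
        insert (((n + 1 : ℕ) : ℤ)) (insert (-((n + 1 : ℕ) : ℤ)) (Finset.Icc (-(n : ℤ)) n)) := by
      ext k
      simp only [Finset.mem_Icc, Finset.mem_insert]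
      omega
    rw [h1, Finset.sum_insert, Finset.sum_insert, ih, Finset.sum_Icc_succ_top (by omega)]
    · have : |(n : ℝ) + 1| = n + 1 := abs_of_nonneg (by positivity)
      push_cast
      rw [abs_neg, this]
      ring
    · simp
    · simp only [Finset.mem_insert, Finset.mem_Icc]
      omega

/-- Modes with `|k| ≤ N` use the pointwise decay `A |k|⁻²`; for the others, `|k|^(2s) ≤ N^(2s-2)
|k|²` and the total bound `B` applies. -/
theorem sobolevNormSq_le_of_cutoff {v : ℝ → ℝ} {A B s : ℝ} (hs0 : 0 < s) (hs : s < 1)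
    (hA0 : 0 ≤ A) (hB0 : 0 ≤ B)
    (hA : ∀ k : ℤ, |(k : ℝ)| ^ 2 * modeSq v k ≤ A)
    (hB : ∑' k : ℤ, ENNReal.ofReal (|(k : ℝ)| ^ 2 * modeSq v k) ≤ ENNReal.ofReal B)
    {N : ℕ} (hN : 1 ≤ N) :
    sobolevNormSq s v ≤ ENNReal.ofReal ((2 * Real.pi) ^ (2 * s) *
      (2 * A * ∑ n ∈ Finset.Icc 1 N, (n : ℝ) ^ (2 * s - 2) + (N : ℝ) ^ (2 * s - 2) * B)) := by
  refine sobolevNormSq_le_of_tsum_le ?_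
  have hN' : (0 : ℝ) < N := by exact_mod_cast hN
  set S := Finset.Icc (-(N : ℤ)) N with hS
  set lo : ℤ → ℝ := fun k => if k ∈ S then A * |(k : ℝ)| ^ (2 * s - 2) else 0 with hlo
  have hlo0 : ∀ k, 0 ≤ lo k := fun k => by
    simp only [hlo]
    split_ifs <;> positivity
  have hterm : ∀ k : ℤ, ENNReal.ofReal (|(k : ℝ)| ^ (2 * s) * modeSq v k) ≤
      ENNReal.ofReal (lo k) + ENNReal.ofReal ((N : ℝ) ^ (2 * s - 2)) *
        ENNReal.ofReal (|(k : ℝ)| ^ 2 * modeSq v k) := by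
    intro k
    have hm := modeSq_nonneg v k
    rw [← ENNReal.ofReal_mul (by positivity), ← ENNReal.ofReal_add (hlo0 k) (by positivity)]
    refine ENNReal.ofReal_le_ofReal ?_
    rcases eq_or_ne k 0 with rfl | hk
    · rw [Int.cast_zero, abs_zero, Real.zero_rpow (by linarith), zero_mul]
      have := hlo0 0
      positivity
    have hk' : 0 < |(k : ℝ)| := by simpa using hk
    by_cases hkS : k ∈ S
    · have h1 := rpow_mul_le_of_sq_mul_le (s := s) hk (hA k)
      have h2 : lo k = A * |(k : ℝ)| ^ (2 * s - 2) := by simp only [hlo, if_pos hkS]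
      rw [h2]
      have : 0 ≤ (N : ℝ) ^ (2 * s - 2) * (|(k : ℝ)| ^ 2 * modeSq v k) := by positivity
      linarith
    · have h3 : (N : ℝ) ≤ |(k : ℝ)| := by
        rw [hS, Finset.mem_Icc, ← abs_le] at hkS
        have : (N : ℤ) ≤ |k| := (not_le.1 hkS).le
        exact_mod_cast this
      have h4 : |(k : ℝ)| ^ (2 * s - 2) ≤ (N : ℝ) ^ (2 * s - 2) :=
        Real.rpow_le_rpow_of_nonpos hN' h3 (by linarith)
      have h1 := rpow_mul_le_of_sq_mul_le (s := s) hk (le_refl (|(k : ℝ)| ^ 2 * modeSq v k))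
      have h5 : 0 ≤ |(k : ℝ)| ^ 2 * modeSq v k := by positivity
      have := mul_le_mul_of_nonneg_left h4 h5
      linarith [hlo0 k]
  refine (ENNReal.tsum_le_tsum hterm).trans ?_
  rw [ENNReal.tsum_add, ENNReal.tsum_mul_left]
  have hfin : ∑' k : ℤ, ENNReal.ofReal (lo k) =
      ENNReal.ofReal (2 * A * ∑ n ∈ Finset.Icc 1 N, (n : ℝ) ^ (2 * s - 2)) := by
    rw [tsum_eq_sum (s := S) fun k hk => by simp [hlo, if_neg hk],
      ← ENNReal.ofReal_sum_of_nonneg fun k _ => hlo0 k]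
    congr 1
    have h1 : ∑ k ∈ S, lo k = ∑ k ∈ S, (fun z : ℝ => A * z ^ (2 * s - 2)) |(k : ℝ)| :=
      Finset.sum_congr rfl fun k hk => by simp only [hlo, if_pos hk]
    -- The zero mode drops out because `0 ^ (2s - 2) = 0` for a nonzero exponent.
    rw [h1, hS, sum_Icc_neg_abs_le (g := fun z : ℝ => A * z ^ (2 * s - 2)), ← Finset.mul_sum, Real.zero_rpow (by linarith)]
    ring
  rw [hfin, ENNReal.ofReal_add (mul_nonneg (by positivity)
    (Finset.sum_nonneg fun n _ => by positivity)) (by positivity),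
    ENNReal.ofReal_mul (p := (N : ℝ) ^ (2 * s - 2)) (by positivity)]
  gcongr

/-- Bernoulli's inequality for the exponent `p ≤ 1` gives `n^(p-1) ≤ (n^p - (n-1)^p) / p`, which
telescopes. -/
theorem sum_rpow_sub_one_le {p : ℝ} (hp0 : 0 < p) (hp1 : p ≤ 1) (N : ℕ) :
    ∑ n ∈ Finset.Icc 1 N, (n : ℝ) ^ (p - 1) ≤ (N : ℝ) ^ p / p := by
  induction N with
  | zero => simp; positivity
  | succ N ih =>
    rw [Finset.sum_Icc_succ_top (by omega)]
    have hn : (0 : ℝ) < ((N + 1 : ℕ) : ℝ) := by positivity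
    set n : ℝ := ((N + 1 : ℕ) : ℝ) with hndef
    have hN : (N : ℝ) = n * (1 + -n⁻¹) := by
      rw [hndef]; push_cast; field_simp; ring
    have hinv : n⁻¹ ≤ 1 := inv_le_one_of_one_le₀ (by rw [hndef]; exact_mod_cast Nat.le_add_left 1 N)
    have h1 := rpow_one_add_le_one_add_mul_self (s := -n⁻¹) (by linarith) hp0.le hp1
    have h2 : (N : ℝ) ^ p ≤ n ^ p * (1 + p * -n⁻¹) := by
      rw [hN, Real.mul_rpow hn.le (by linarith)]
      gcongr
    have h3 : n ^ (p - 1) = n ^ p * n⁻¹ := by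
      rw [Real.rpow_sub_one hn.ne', div_eq_mul_inv]
    refine (add_le_add_left ih _).trans ?_
    rw [h3, ← sub_nonneg]
    have : n ^ p / p - ((N : ℝ) ^ p / p + n ^ p * n⁻¹) =
        (n ^ p * (1 + p * -n⁻¹) - (N : ℝ) ^ p) / p := by
      field_simp; ring
    rw [this]
    exact div_nonneg (sub_nonneg.2 h2) hp0.le

theorem sum_inv_le_one_add_log (N : ℕ) :
    ∑ n ∈ Finset.Icc 1 N, (n : ℝ)⁻¹ ≤ 1 + Real.log N := by
  have := harmonic_le_one_add_log N
  rw [harmonic_eq_sum_Icc] at this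
  push_cast at this
  exact this

/-! ### Upper bounds for Sobolev norms of solutions -/

namespace IsAdmissible

variable {f : ℝ → ℝ} {σ D M ν : ℝ} {u : ℝ → ℝ → ℝ}

/-- The coefficients of `u_x` are bounded by `∫ |u_x| ≤ 2D`, and `(2π)² ≥ 4` absorbs the factor. -/
theorem sq_mul_modeSq_le (h : IsAdmissible f σ D M ν u) {t : ℝ} (ht : 0 < t) (k : ℤ) :
    |(k : ℝ)| ^ 2 * modeSq (u t) k ≤ D ^ 2 := by
  have h1 := modeSq_deriv (h.sol.hasDerivAt_space ht) (h.continuous_deriv ht)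
    (h.sol.periodic t ht.le) k
  have h2 := (modeSq_le_sq_integral_abs (deriv (u t)) k).trans
    (pow_le_pow_left₀ (intervalIntegral.integral_nonneg zero_le_one fun x _ => abs_nonneg _)
      (h.integral_abs_deriv_le ht) 2)
  rw [h1] at h2
  have h3 : 0 ≤ |(k : ℝ)| ^ 2 * modeSq (u t) k := mul_nonneg (sq_nonneg _) (modeSq_nonneg _ _)
  have h4 : 4 ≤ (2 * Real.pi) ^ 2 := by nlinarith [Real.pi_gt_three]
  nlinarith [mul_le_mul_of_nonneg_right h4 h3]

theorem tsum_sq_mul_modeSq_le (h : IsAdmissible f σ D M ν u) {t : ℝ} (ht : 0 < t) :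
    ∑' k : ℤ, ENNReal.ofReal (|(k : ℝ)| ^ 2 * modeSq (u t) k) ≤
      ENNReal.ofReal (4 * D ^ 2 * M / ν) := by
  refine le_trans ?_ (ENNReal.ofReal_le_ofReal (h.integral_sq_deriv_le ht))
  rw [ofReal_integral_sq_eq_tsum (h.continuous_deriv ht)]
  refine ENNReal.tsum_le_tsum fun k => ENNReal.ofReal_le_ofReal ?_
  rw [modeSq_deriv (h.sol.hasDerivAt_space ht) (h.continuous_deriv ht) (h.sol.periodic t ht.le) k]
  exact le_mul_of_one_le_left (mul_nonneg (sq_nonneg _) (modeSq_nonneg _ _))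
    (by nlinarith [Real.pi_gt_three])

theorem sobolevNormSq_le (h : IsAdmissible f σ D M ν u) {t : ℝ} (ht : 0 < t) {s : ℝ} (hs0 : 0 < s)
    (hs : s < 1) : ∃ N : ℕ, 1 ≤ N ∧ ν⁻¹ ≤ N ∧ (N : ℝ) ≤ 2 * ν⁻¹ ∧
    sobolevNormSq s (u t) ≤ ENNReal.ofReal ((2 * Real.pi) ^ (2 * s) *
      (2 * D ^ 2 * ∑ n ∈ Finset.Icc 1 N, (n : ℝ) ^ (2 * s - 2) +
        4 * D ^ 2 * M * ν ^ (-(2 * s - 1)))) := by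
  have hν := h.nu_pos
  have hM := h.one_le_bound
  have h1 : 1 ≤ ν⁻¹ := (one_le_inv₀ hν).2 h.nu_mem.2
  -- The cutoff `1/ν` is where the two available bounds balance.
  have hN1 : ν⁻¹ ≤ (⌈ν⁻¹⌉₊ : ℝ) := Nat.le_ceil _
  have hN : 1 ≤ ⌈ν⁻¹⌉₊ := by exact_mod_cast h1.trans hN1
  refine ⟨⌈ν⁻¹⌉₊, hN, hN1, ?_, ?_⟩
  · linarith [Nat.ceil_lt_add_one (inv_nonneg.2 hν.le)]
  · refine (sobolevNormSq_le_of_cutoff hs0 hs (sq_nonneg D) (by positivity)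
      (h.sq_mul_modeSq_le ht) (h.tsum_sq_mul_modeSq_le ht) hN).trans (ENNReal.ofReal_le_ofReal ?_)
    have h2 : (⌈ν⁻¹⌉₊ : ℝ) ^ (2 * s - 2) ≤ ν⁻¹ ^ (2 * s - 2) :=
      Real.rpow_le_rpow_of_nonpos (by positivity) hN1 (by linarith)
    have h3 : ν⁻¹ ^ (2 * s - 2) * (4 * D ^ 2 * M / ν) = 4 * D ^ 2 * M * ν ^ (-(2 * s - 1)) := by
      rw [Real.inv_rpow hν.le, ← Real.rpow_neg hν.le,
        show -(2 * s - 1) = -(2 * s - 2) - 1 by ring, Real.rpow_sub_one hν.ne']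
      ring
    have h4 := mul_le_mul_of_nonneg_right h2 (show 0 ≤ 4 * D ^ 2 * M / ν by positivity)
    rw [h3] at h4
    gcongr

end IsAdmissible

/-- An upper bound for `‖u(t)‖_s²` which is uniform in `t > 0`. -/
def SobolevUpperBound (f : ℝ → ℝ) (σ D M ν₀ s : ℝ) (Y : ℝ → ℝ) : Prop :=
  ∃ C : ℝ, 0 < C ∧ ∀ ν ∈ Ioc (0 : ℝ) ν₀, ∀ u : ℝ → ℝ → ℝ, IsAdmissible f σ D M ν u →
    ∀ t, 0 < t → sobolevNormSq s (u t) ≤ ENNReal.ofReal (C * Y ν)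

theorem sobolevUpperBound_of_lt_half (f : ℝ → ℝ) (σ D M ν₀ : ℝ) {s : ℝ} (hs0 : 0 < s)
    (hs : s < 1 / 2) : SobolevUpperBound f σ D M ν₀ s fun _ => 1 := by
  set T := (2 * Real.pi) ^ (2 * s) * (D ^ 2 * ∑' k : ℤ, |(k : ℝ)| ^ (-(2 - 2 * s)))
  refine ⟨max 1 T, by positivity, fun ν _ u hu t ht => ?_⟩
  refine (sobolevNormSq_le_of_lt_half hs0 hs (sq_nonneg D) (hu.sq_mul_modeSq_le ht)).trans
    (ENNReal.ofReal_le_ofReal ?_)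
  rw [mul_one]
  exact le_max_right _ _

theorem one_le_neg_log {ν : ℝ} (hν : ν ∈ Ioc (0 : ℝ) (1 / 4)) : 1 ≤ -Real.log ν := by
  have h1 : Real.log ν ≤ Real.log (1 / 4) := Real.log_le_log hν.1 hν.2
  have h2 : Real.log (1 / 4) = -(2 * Real.log 2) := by
    rw [show (1 / 4 : ℝ) = (2 ^ 2)⁻¹ by norm_num, Real.log_inv, Real.log_pow]
    norm_num
  linarith [Real.log_two_gt_d9]

theorem sobolevUpperBound_half (f : ℝ → ℝ) (σ : ℝ) {D M ν₀ : ℝ} (hD : 0 < D) (hM : 1 ≤ M)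
    (hν₀ : ν₀ ≤ 1 / 4) : SobolevUpperBound f σ D M ν₀ (1 / 2) fun ν => |Real.log ν| := by
  refine ⟨(2 * Real.pi) ^ (2 * (1 / 2) : ℝ) * (2 * D ^ 2 * 3 + 4 * D ^ 2 * M), by positivity,
    fun ν hν u hu t ht => ?_⟩
  obtain ⟨N, hN1, -, hN2, hle⟩ := hu.sobolevNormSq_le ht (s := 1 / 2) (by norm_num) (by norm_num)
  refine hle.trans (ENNReal.ofReal_le_ofReal ?_)
  have hl := one_le_neg_log ⟨hν.1, hν.2.trans hν₀⟩
  simp only [abs_of_neg (by linarith : Real.log ν < 0)]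
  -- Since `ν ≤ 1/4`, `|log ν| ≥ 1` absorbs the additive constant `1 + log 2`.
  have h1 : ∑ n ∈ Finset.Icc 1 N, (n : ℝ) ^ (2 * (1 / 2) - 2 : ℝ) ≤ 3 * -Real.log ν := by
    have e : (2 * (1 / 2) - 2 : ℝ) = -1 := by norm_num
    simp only [e, Real.rpow_neg_one]
    refine (sum_inv_le_one_add_log N).trans ?_
    have h2 : Real.log N ≤ Real.log (2 * ν⁻¹) :=
      Real.log_le_log (by exact_mod_cast hN1) hN2
    rw [Real.log_mul two_ne_zero (inv_ne_zero hν.1.ne'), Real.log_inv] at h2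
    linarith [Real.log_two_lt_d9]
  have h2 : ν ^ (-(2 * (1 / 2) - 1) : ℝ) ≤ -Real.log ν := by
    have e : (-(2 * (1 / 2) - 1) : ℝ) = 0 := by norm_num
    rw [e, Real.rpow_zero]
    exact hl
  have h3 := mul_le_mul_of_nonneg_left h1 (show 0 ≤ 2 * D ^ 2 by positivity)
  have h4 := mul_le_mul_of_nonneg_left h2 (show 0 ≤ 4 * D ^ 2 * M by positivity)
  rw [mul_assoc ((2 * Real.pi) ^ (_ : ℝ))]
  refine mul_le_mul_of_nonneg_left ?_ ?_
  · linarith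
  · positivity

theorem sobolevUpperBound_of_half_lt (f : ℝ → ℝ) (σ : ℝ) {D M : ℝ} (ν₀ : ℝ) (hD : 0 < D)
    (hM : 1 ≤ M) {s : ℝ} (hs0 : 1 / 2 < s) (hs : s < 1) :
    SobolevUpperBound f σ D M ν₀ s fun ν => ν ^ (-(2 * s - 1)) := by
  have hp : 0 < 2 * s - 1 := by linarith
  refine ⟨(2 * Real.pi) ^ (2 * s) * (2 * D ^ 2 * (2 / (2 * s - 1)) + 4 * D ^ 2 * M),
    by positivity, fun ν hν u hu t ht => ?_⟩
  obtain ⟨N, hN1, -, hN2, hle⟩ := hu.sobolevNormSq_le ht (s := s) (by linarith) hs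
  refine hle.trans (ENNReal.ofReal_le_ofReal ?_)
  have h1 : ∑ n ∈ Finset.Icc 1 N, (n : ℝ) ^ (2 * s - 2) ≤
      2 / (2 * s - 1) * ν ^ (-(2 * s - 1)) := by
    have h2 := sum_rpow_sub_one_le (p := 2 * s - 1) hp (by linarith) N
    rw [show 2 * s - 1 - 1 = 2 * s - 2 by ring] at h2
    have h3 : (N : ℝ) ^ (2 * s - 1) ≤ 2 * ν ^ (-(2 * s - 1)) := by
      refine (Real.rpow_le_rpow (by positivity) hN2 hp.le).trans ?_
      have hν := hν.1
      rw [Real.mul_rpow (by norm_num) (by positivity), Real.inv_rpow hν.le, Real.rpow_neg hν.le]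
      gcongr
      calc (2 : ℝ) ^ (2 * s - 1) ≤ 2 ^ (1 : ℝ) :=
            Real.rpow_le_rpow_of_exponent_le (by norm_num) (by linarith)
        _ = 2 := Real.rpow_one 2
    refine h2.trans ?_
    rw [div_mul_eq_mul_div]
    gcongr
  have h3 := mul_le_mul_of_nonneg_left h1 (show 0 ≤ 2 * D ^ 2 by positivity)
  rw [mul_assoc ((2 * Real.pi) ^ (_ : ℝ))]
  refine mul_le_mul_of_nonneg_left ?_ ?_
  · linarith
  · positivity

/-! ### Integrals depending on a parameter -/

theorem continuousOn_intervalIntegral {X : Type*} [TopologicalSpace X] {S : Set X} {F : X → ℝ → ℝ}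
    (hF : ContinuousOn (Function.uncurry F) (S ×ˢ univ)) (a b : ℝ) :
    ContinuousOn (fun p => ∫ y in a..b, F p y) S := by
  rw [continuousOn_iff_continuous_domRestrict]
  have h : Continuous (Function.uncurry fun (p : S) (y : ℝ) => F p y) := by
    have h2 : Continuous fun q : S × ℝ => ((q.1 : X), q.2) := by fun_prop
    exact hF.comp_continuous h2 fun q => ⟨q.1.2, mem_univ _⟩
  exact intervalIntegral.continuous_parametric_intervalIntegral_of_continuous' h a b

theorem hasDerivAt_intervalIntegral {G G' : ℝ → ℝ → ℝ}
    (hG : ContinuousOn (Function.uncurry G) (Ioi (0 : ℝ) ×ˢ univ))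
    (hG' : ContinuousOn (Function.uncurry G') (Ioi (0 : ℝ) ×ˢ univ))
    (hd : ∀ t, 0 < t → ∀ x, HasDerivAt (fun τ => G τ x) (G' t x) t) (a b : ℝ) {t : ℝ}
    (ht : 0 < t) :
    HasDerivAt (fun τ => ∫ x in a..b, G τ x) (∫ x in a..b, G' t x) t := by
  have hslice : ∀ {H : ℝ → ℝ → ℝ}, ContinuousOn (Function.uncurry H) (Ioi (0 : ℝ) ×ˢ univ) →
      ∀ τ, 0 < τ → Continuous (H τ) := fun {H} hH τ hτ =>
    hH.comp_continuous (f := fun x : ℝ => (τ, x)) (by fun_prop) fun x => ⟨hτ, mem_univ _⟩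
  have hsub : Icc (t / 2) (2 * t) ×ˢ uIcc a b ⊆ Ioi (0 : ℝ) ×ˢ univ := fun p hp =>
    ⟨lt_of_lt_of_le (by linarith) hp.1.1, mem_univ _⟩
  obtain ⟨C, hC⟩ := (isCompact_Icc.prod isCompact_uIcc).exists_bound_of_continuousOn
    (hG'.mono hsub)
  have hs : Icc (t / 2) (2 * t) ∈ nhds t := Icc_mem_nhds (by linarith) (by linarith)
  refine (intervalIntegral.hasDerivAt_integral_of_dominated_loc_of_deriv_le (μ := volume)
    (bound := fun _ => C) hs ?_ ((hslice hG t ht).intervalIntegrable _ _)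
    (hslice hG' t ht).aestronglyMeasurable ?_ (by simp) ?_).2
  · filter_upwards [Ioi_mem_nhds ht] with τ hτ using (hslice hG τ hτ).aestronglyMeasurable
  · exact Filter.Eventually.of_forall fun x hx τ hτ => hC (τ, x) ⟨hτ, uIoc_subset_uIcc hx⟩
  · exact Filter.Eventually.of_forall fun x hx τ hτ => hd τ (by linarith [hτ.1]) x

theorem Function.Periodic.integral_sub_translate {g : ℝ → ℝ} (hp : Function.Periodic g 1)
    (hg : Continuous g) (ℓ : ℝ) : ∫ x in (0 : ℝ)..1, (g (x + ℓ) - g x) = 0 := by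
  rw [intervalIntegral.integral_sub (Continuous.intervalIntegrable (by fun_prop) _ _)
    (hg.intervalIntegrable _ _), intervalIntegral.integral_comp_add_right, zero_add, add_comm 1 ℓ,
    hp.intervalIntegral_add_eq ℓ 0, zero_add, sub_self]

theorem Function.Periodic.integral_eq_zero_of_hasDerivAt {g g' : ℝ → ℝ}
    (hp : Function.Periodic g 1) (hd : ∀ x, HasDerivAt g (g' x) x) (hg' : Continuous g') :
    ∫ x in (0 : ℝ)..1, g' x = 0 := by
  rw [intervalIntegral.integral_eq_sub_of_hasDerivAt (fun x _ => hd x)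
    (hg'.intervalIntegrable _ _)]
  have := hp 0
  rw [zero_add] at this
  rw [this, sub_self]

/-- One-sided error of the trapezoidal rule for a Lipschitz integrand. -/
theorem trapezoid_ge {f : ℝ → ℝ} (hf : Differentiable ℝ f) {D M : ℝ}
    (hM : ∀ x ∈ Icc (-D) D, |deriv f x| ≤ M) {a b : ℝ} (ha : |a| ≤ D) (hb : |b| ≤ D) :
    2 * ∫ z in a..b, f z ≤ (f a + f b) * (b - a) + 2 * M * (b - a) ^ 2 := by
  have hlip : ∀ y ∈ Icc (-D) D, ∀ z ∈ Icc (-D) D, |f z - f y| ≤ M * |z - y| := fun y hy z hz =>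
    (convex_Icc (-D) D).norm_image_sub_le_of_norm_deriv_le (fun x _ => hf x)
      (fun x hx => hM x hx) hy hz
  have ha' := abs_le.1 ha
  have hb' := abs_le.1 hb
  have hM0 : 0 ≤ M := (abs_nonneg _).trans (hM a ha')
  have key : ∀ c ∈ uIcc a b, |∫ z in a..b, (f z - f c)| ≤ M * (b - a) ^ 2 := by
    intro c hc
    have hsub : uIcc a b ⊆ Icc (-D) D := uIcc_subset_Icc ha' hb'
    have h1 := intervalIntegral.norm_integral_le_of_norm_le_const (a := a) (b := b)
      (f := fun z => f z - f c) (C := M * |b - a|) fun z hz => by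
        refine (hlip c (hsub hc) z (hsub (uIoc_subset_uIcc hz))).trans ?_
        refine mul_le_mul_of_nonneg_left ?_ hM0
        have h := Real.dist_le_of_mem_uIcc (uIoc_subset_uIcc hz) hc
        rwa [Real.dist_eq, Real.dist_eq, abs_sub_comm a b] at h
    rwa [mul_assoc, ← sq, sq_abs] at h1
  have hc := hf.continuous
  have e : ∀ c, ∫ z in a..b, (f z - f c) = (∫ z in a..b, f z) - f c * (b - a) := fun c => by
    rw [intervalIntegral.integral_sub (hc.intervalIntegrable _ _) (by simp),
      intervalIntegral.integral_const, smul_eq_mul, mul_comm]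
  have k1 := (le_abs_self _).trans (key a left_mem_uIcc)
  have k2 := (le_abs_self _).trans (key b right_mem_uIcc)
  rw [e] at k1 k2
  linarith

/-! ### Energy and correlation balances -/

section Balance

variable {f : ℝ → ℝ} {ν : ℝ} {u : ℝ → ℝ → ℝ}

/-- The viscous flux `-f(u) + ν u_x`, whose `x`-derivative is `u_t`. -/
noncomputable def viscousFlux (f : ℝ → ℝ) (ν : ℝ) (u : ℝ → ℝ → ℝ) (t x : ℝ) : ℝ :=
  -f (u t x) + ν * deriv (u t) x

/-- The time derivative `u_t`, expressed through `x`-derivatives. -/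
noncomputable def timeDeriv (f : ℝ → ℝ) (ν : ℝ) (u : ℝ → ℝ → ℝ) (t x : ℝ) : ℝ :=
  -(deriv f (u t x) * deriv (u t) x) + ν * deriv (deriv (u t)) x

/-- `∫₀^ℓ u(t, x + y) dy`. -/
noncomputable def windowIntegral (u : ℝ → ℝ → ℝ) (ℓ t x : ℝ) : ℝ :=
  ∫ y in (0 : ℝ)..ℓ, u t (x + y)

namespace IsBurgersSolution

theorem continuousOn_pos (hu : IsBurgersSolution f ν u) :
    ContinuousOn (Function.uncurry u) (Ioi (0 : ℝ) ×ˢ univ) := hu.smooth.continuousOn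

theorem continuousOn_deriv (hu : IsBurgersSolution f ν u) :
    ContinuousOn (Function.uncurry fun t => deriv (u t)) (Ioi (0 : ℝ) ×ˢ univ) :=
  (contDiffOn_deriv_right hu.smooth).continuousOn

theorem continuousOn_timeDeriv (hu : IsBurgersSolution f ν u) (hf : ContDiff ℝ ∞ f) :
    ContinuousOn (Function.uncurry (timeDeriv f ν u)) (Ioi (0 : ℝ) ×ˢ univ) := by
  have h1 := (contDiffOn_deriv_right (contDiffOn_deriv_right hu.smooth)).continuousOn
  have h2 : Continuous (deriv f) := hf.continuous_deriv (by simp)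
  exact ((h2.comp_continuousOn hu.continuousOn_pos).mul hu.continuousOn_deriv).neg.add
    (continuousOn_const.mul h1)

theorem continuousOn_viscousFlux (hu : IsBurgersSolution f ν u) (hf : ContDiff ℝ ∞ f) :
    ContinuousOn (Function.uncurry (viscousFlux f ν u)) (Ioi (0 : ℝ) ×ˢ univ) :=
  (hf.continuous.comp_continuousOn hu.continuousOn_pos).neg.add
    (continuousOn_const.mul hu.continuousOn_deriv)

theorem continuous_slice_of_continuousOn {H : ℝ → ℝ → ℝ}
    (hH : ContinuousOn (Function.uncurry H) (Ioi (0 : ℝ) ×ˢ univ)) {t : ℝ} (ht : 0 < t) :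
    Continuous (H t) :=
  hH.comp_continuous (f := fun x : ℝ => (t, x)) (by fun_prop) fun _ => ⟨ht, mem_univ _⟩

theorem hasDerivAt_viscousFlux (hu : IsBurgersSolution f ν u) (hf : ContDiff ℝ ∞ f) {t : ℝ}
    (ht : 0 < t) (x : ℝ) : HasDerivAt (viscousFlux f ν u t) (timeDeriv f ν u t x) x := by
  have h1 : HasDerivAt f (deriv f (u t x)) (u t x) :=
    (hf.differentiable (by simp) _).hasDerivAt
  exact (h1.comp x (hu.hasDerivAt_space ht x)).fun_neg.fun_add
    ((hu.hasDerivAt_space_deriv ht x).const_mul ν)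

theorem periodic_deriv (hu : IsBurgersSolution f ν u) {t : ℝ} (ht : 0 < t) :
    Function.Periodic (deriv (u t)) 1 := by
  intro x
  rw [← deriv_comp_add_const]
  congr 1
  exact funext (hu.periodic t ht.le)

theorem periodic_viscousFlux (hu : IsBurgersSolution f ν u) {t : ℝ} (ht : 0 < t) :
    Function.Periodic (viscousFlux f ν u t) 1 := fun x => by
  simp only [viscousFlux, hu.periodic t ht.le x, hu.periodic_deriv ht x]

/-- Integration by parts against a periodic function. -/
theorem integral_timeDeriv_mul (hu : IsBurgersSolution f ν u) (hf : ContDiff ℝ ∞ f) {t : ℝ}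
    (ht : 0 < t) {w w' : ℝ → ℝ} (hw : ∀ x, HasDerivAt w (w' x) x) (hw' : Continuous w')
    (hper : Function.Periodic w 1) :
    ∫ x in (0 : ℝ)..1, timeDeriv f ν u t x * w x =
      -∫ x in (0 : ℝ)..1, viscousFlux f ν u t x * w' x := by
  have hc1 := continuous_slice_of_continuousOn (hu.continuousOn_timeDeriv hf) ht
  have hc2 := continuous_slice_of_continuousOn (hu.continuousOn_viscousFlux hf) ht
  have hwc : Continuous w := continuous_iff_continuousAt.2 fun x => (hw x).continuousAt
  have h0 := Function.Periodic.integral_eq_zero_of_hasDerivAt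
    (g := fun x => viscousFlux f ν u t x * w x)
    (fun x => by simp only [hu.periodic_viscousFlux ht x, hper x])
    (fun x => (hu.hasDerivAt_viscousFlux hf ht x).mul (hw x)) (by fun_prop)
  rw [intervalIntegral.integral_add (Continuous.intervalIntegrable (by fun_prop) _ _)
    (Continuous.intervalIntegrable (by fun_prop) _ _)] at h0
  linarith

/-- Only viscosity dissipates: `f(u) u_x` is the derivative of a periodic function. -/
theorem hasDerivAt_energy (hu : IsBurgersSolution f ν u) (hf : ContDiff ℝ ∞ f) {t : ℝ}
    (ht : 0 < t) : HasDerivAt (fun τ => ∫ x in (0 : ℝ)..1, u τ x ^ 2)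
      (-(2 * ν) * ∫ x in (0 : ℝ)..1, deriv (u t) x ^ 2) t := by
  have h1 := hasDerivAt_intervalIntegral (G := fun t x => u t x ^ 2)
    (G' := fun t x => 2 * (timeDeriv f ν u t x * u t x)) (hu.continuousOn_pos.fun_pow 2)
    (continuousOn_const.fun_mul ((hu.continuousOn_timeDeriv hf).fun_mul hu.continuousOn_pos))
    (fun t ht x => ((hu.hasDerivAt_time ht x).fun_pow 2).congr_deriv (by
      simp only [timeDeriv]; push_cast; ring)) 0 1 ht
  refine h1.congr_deriv ?_
  have hdc := (hu.contDiff_deriv ht).continuous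
  have huc := hu.continuous_slice ht.le
  have hfc := hf.continuous
  rw [intervalIntegral.integral_const_mul, hu.integral_timeDeriv_mul hf ht
    (hu.hasDerivAt_space ht) hdc (hu.periodic t ht.le)]
  have h2 : ∫ x in (0 : ℝ)..1, f (u t x) * deriv (u t) x = 0 := by
    refine Function.Periodic.integral_eq_zero_of_hasDerivAt
      (g := fun x => ∫ z in (0 : ℝ)..(u t x), f z)
      (fun x => by simp only [hu.periodic t ht.le x]) (fun x => ?_) (by fun_prop)
    exact (hfc.integral_hasStrictDerivAt 0 (u t x)).hasDerivAt.comp x (hu.hasDerivAt_space ht x)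
  have h3 : ∀ x, viscousFlux f ν u t x * deriv (u t) x =
      -(f (u t x) * deriv (u t) x) + ν * deriv (u t) x ^ 2 := fun x => by
    simp only [viscousFlux]; ring
  simp only [h3]
  rw [intervalIntegral.integral_add (Continuous.intervalIntegrable (by fun_prop) _ _)
    (Continuous.intervalIntegrable (by fun_prop) _ _), intervalIntegral.integral_neg, h2,
    intervalIntegral.integral_const_mul]
  ring

theorem continuousOn_windowIntegral (hu : IsBurgersSolution f ν u) (ℓ : ℝ) :
    ContinuousOn (Function.uncurry (windowIntegral u ℓ)) (Ioi (0 : ℝ) ×ˢ univ) := by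
  refine continuousOn_intervalIntegral (F := fun (p : ℝ × ℝ) y => u p.1 (p.2 + y)) ?_ 0 ℓ
  exact hu.continuousOn_pos.comp (f := fun q : (ℝ × ℝ) × ℝ => (q.1.1, q.1.2 + q.2)) (by fun_prop)
    fun q hq => ⟨hq.1.1, mem_univ _⟩

theorem hasDerivAt_windowIntegral_time (hu : IsBurgersSolution f ν u) (hf : ContDiff ℝ ∞ f)
    (ℓ : ℝ) {t : ℝ} (ht : 0 < t) (x : ℝ) : HasDerivAt (fun τ => windowIntegral u ℓ τ x)
      (viscousFlux f ν u t (x + ℓ) - viscousFlux f ν u t x) t := by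
  have hshift : ∀ {H : ℝ → ℝ → ℝ}, ContinuousOn (Function.uncurry H) (Ioi (0 : ℝ) ×ˢ univ) →
      ContinuousOn (Function.uncurry fun t y => H t (x + y)) (Ioi (0 : ℝ) ×ˢ univ) :=
    fun {H} hH => hH.comp (f := fun q : ℝ × ℝ => (q.1, x + q.2)) (by fun_prop)
      fun q hq => ⟨hq.1, mem_univ _⟩
  have h1 := hasDerivAt_intervalIntegral (G := fun t y => u t (x + y))
    (G' := fun t y => timeDeriv f ν u t (x + y)) (hshift hu.continuousOn_pos)
    (hshift (hu.continuousOn_timeDeriv hf)) (fun t ht y => hu.hasDerivAt_time ht (x + y)) 0 ℓ ht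
  refine h1.congr_deriv ?_
  have hc := continuous_slice_of_continuousOn (hu.continuousOn_timeDeriv hf) ht
  rw [intervalIntegral.integral_comp_add_left (fun y => timeDeriv f ν u t y), add_zero,
    intervalIntegral.integral_eq_sub_of_hasDerivAt
      (fun y _ => hu.hasDerivAt_viscousFlux hf ht y) (hc.intervalIntegrable _ _)]

theorem hasDerivAt_windowIntegral_space (hu : IsBurgersSolution f ν u) (ℓ : ℝ) {t : ℝ}
    (ht : 0 ≤ t) (x : ℝ) : HasDerivAt (windowIntegral u ℓ t) (u t (x + ℓ) - u t x) x := by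
  have hc := hu.continuous_slice ht
  have e : windowIntegral u ℓ t =
      fun x => (∫ y in (0 : ℝ)..(x + ℓ), u t y) - ∫ y in (0 : ℝ)..x, u t y := by
    funext x
    rw [windowIntegral, intervalIntegral.integral_comp_add_left (fun y => u t y), add_zero,
      intervalIntegral.integral_interval_sub_left (hc.intervalIntegrable _ _)
        (hc.intervalIntegrable _ _)]
  rw [e]
  exact ((hc.integral_hasStrictDerivAt 0 (x + ℓ)).hasDerivAt.comp_add_const x ℓ).fun_sub
    (hc.integral_hasStrictDerivAt 0 x).hasDerivAt

theorem periodic_windowIntegral (hu : IsBurgersSolution f ν u) (ℓ : ℝ) {t : ℝ} (ht : 0 ≤ t) :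
    Function.Periodic (windowIntegral u ℓ t) 1 := by
  intro x
  simp only [windowIntegral]
  refine intervalIntegral.integral_congr fun y _ => ?_
  rw [add_right_comm, hu.periodic t ht]

/-- A Kármán–Howarth type identity. -/
theorem hasDerivAt_correlation (hu : IsBurgersSolution f ν u) (hf : ContDiff ℝ ∞ f) (ℓ : ℝ)
    {t : ℝ} (ht : 0 < t) :
    HasDerivAt (fun τ => ∫ x in (0 : ℝ)..1, u τ x * windowIntegral u ℓ τ x)
      (∫ x in (0 : ℝ)..1, (u t x * viscousFlux f ν u t (x + ℓ) -
        viscousFlux f ν u t x * u t (x + ℓ))) t := by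
  have hwc := hu.continuousOn_windowIntegral ℓ
  have hfl := hu.continuousOn_viscousFlux hf
  have hfl' : ContinuousOn (Function.uncurry fun t x => viscousFlux f ν u t (x + ℓ))
      (Ioi (0 : ℝ) ×ˢ univ) :=
    hfl.comp (f := fun q : ℝ × ℝ => (q.1, q.2 + ℓ)) (by fun_prop) fun q hq => ⟨hq.1, mem_univ _⟩
  have h1 := hasDerivAt_intervalIntegral (G := fun t x => u t x * windowIntegral u ℓ t x)
    (G' := fun t x => timeDeriv f ν u t x * windowIntegral u ℓ t x +
      u t x * (viscousFlux f ν u t (x + ℓ) - viscousFlux f ν u t x))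
    (hu.continuousOn_pos.mul hwc)
    (((hu.continuousOn_timeDeriv hf).mul hwc).add (hu.continuousOn_pos.mul (hfl'.sub hfl)))
    (fun t ht x => (hu.hasDerivAt_time ht x).fun_mul (hu.hasDerivAt_windowIntegral_time hf ℓ ht x))
    0 1 ht
  refine h1.congr_deriv ?_
  have c1 := hu.continuous_slice ht.le
  have c2 := continuous_slice_of_continuousOn hfl ht
  have c3 := continuous_slice_of_continuousOn hwc ht
  have c4 := continuous_slice_of_continuousOn (hu.continuousOn_timeDeriv hf) ht
  rw [intervalIntegral.integral_add (Continuous.intervalIntegrable (by fun_prop) _ _)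
    (Continuous.intervalIntegrable (by fun_prop) _ _),
    hu.integral_timeDeriv_mul hf ht (hu.hasDerivAt_windowIntegral_space ℓ ht.le) (by fun_prop)
      (hu.periodic_windowIntegral ℓ ht.le), ← intervalIntegral.integral_neg,
    ← intervalIntegral.integral_add (Continuous.intervalIntegrable (by fun_prop) _ _)
    (Continuous.intervalIntegrable (by fun_prop) _ _)]
  refine intervalIntegral.integral_congr fun x _ => ?_
  ring

end IsBurgersSolution

end Balance

namespace IsAdmissible

variable {f : ℝ → ℝ} {σ D M ν : ℝ} {u : ℝ → ℝ → ℝ}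

/-- The initial energy is at least `D⁻²`, and the dissipation rate `2ν ∫ u_x²` is at most `2 Ct` by
the choice of `Ct`. -/
theorem energy_ge (h : IsAdmissible f σ D M ν u) {Ct : ℝ} (hCt : IsH1Constant f D Ct) {t : ℝ}
    (ht : 0 ≤ t) : (D ^ 2)⁻¹ - 2 * Ct * t ≤ ∫ x in (0 : ℝ)..1, u t x ^ 2 := by
  have hν := h.nu_pos
  refine le_trans (sub_le_sub_right
    (inv_sq_le_integral_sq_of_initialD_eq h.continuous_initial h.initialD_eq) _) ?_
  have hcont : ContinuousOn (fun τ => ∫ x in (0 : ℝ)..1, u τ x ^ 2) (Icc 0 t) :=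
    (continuousOn_intervalIntegral (F := fun τ x => u τ x ^ 2) (S := Ici (0 : ℝ))
      (h.sol.continuousOn.fun_pow 2) 0 1).mono Icc_subset_Ici_self
  have h1 := intervalIntegral.sub_le_integral_of_hasDeriv_right_of_le ht hcont.neg
    (g' := fun τ => 2 * ν * ∫ x in (0 : ℝ)..1, deriv (u τ) x ^ 2) (φ := fun _ => 2 * Ct)
    (fun τ hτ => ((h.sol.hasDerivAt_energy h.smooth_flux hτ.1).neg.congr_deriv
      (by ring)).hasDerivWithinAt) continuous_const.integrableOn_Icc (fun τ hτ => by
        have h2 := hCt.2 ν h.nu_mem u h.sol h.initialD_eq τ hτ.1.le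
        rw [circleLpNorm_two_sq_eq (h.continuous_deriv hτ.1),
          ENNReal.ofReal_le_ofReal_iff (mul_nonneg hCt.1.le (inv_nonneg.2 hν.le))] at h2
        have h3 := mul_le_mul_of_nonneg_left h2 (show 0 ≤ 2 * ν by positivity)
        have h4 : 2 * ν * (Ct * ν⁻¹) = 2 * Ct := by field_simp
        linarith)
  simp only [Pi.neg_apply, intervalIntegral.integral_const, smul_eq_mul, sub_zero] at h1
  linarith

/-- After this time the Oleinik decay gives `|u| ≤ 1 / (2D)`, hence energy at most half of the
guaranteed value at `T₁`. -/
theorem energy_le (h : IsAdmissible f σ D M ν u) {t : ℝ} (ht : 2 * D * σ⁻¹ ≤ t) :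
    ∫ x in (0 : ℝ)..1, u t x ^ 2 ≤ (D ^ 2)⁻¹ / 4 := by
  have hD := h.D_pos
  have hσ := h.sigma_pos
  have ht0 : 0 < t := lt_of_lt_of_le (by positivity) ht
  have hc := h.sol.continuous_slice ht0.le
  have h1 : ∀ x, u t x ^ 2 ≤ (D ^ 2)⁻¹ / 4 := by
    intro x
    have h2 : D / (1 + σ * D * t) ≤ (2 * D)⁻¹ := by
      rw [div_le_iff₀ (by positivity), le_inv_mul_iff₀ (by positivity)]
      have : 2 * D ≤ σ * t := by
        rw [← div_eq_mul_inv, div_le_iff₀ hσ] at ht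
        linarith
      nlinarith
    rw [← sq_abs]
    refine (pow_le_pow_left₀ (abs_nonneg _) ((h.abs_le ht0.le x).trans h2) 2).trans (le_of_eq ?_)
    rw [mul_inv, mul_pow, inv_pow]
    ring
  have h3 := intervalIntegral.integral_mono_on (μ := volume) (zero_le_one : (0 : ℝ) ≤ 1)
    (f := fun x => u t x ^ 2) (g := fun _ => (D ^ 2)⁻¹ / 4)
    (Continuous.intervalIntegrable (by fun_prop) _ _)
    (continuous_const.intervalIntegrable _ _) fun x _ => h1 x
  simpa using h3

theorem abs_correlation_sub_le (h : IsAdmissible f σ D M ν u) {ℓ : ℝ} (hℓ : ℓ ∈ Icc (0 : ℝ) 1)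
    {t : ℝ} (ht : 0 < t) :
    |(∫ x in (0 : ℝ)..1, u t x * windowIntegral u ℓ t x) - ℓ * ∫ x in (0 : ℝ)..1, u t x ^ 2| ≤
      2 * D ^ 2 * ℓ ^ 2 := by
  have hD := h.D_pos
  have hc := h.sol.continuous_slice ht.le
  have hw := IsBurgersSolution.continuous_slice_of_continuousOn
    (h.sol.continuousOn_windowIntegral ℓ) ht
  have hmean : ∫ x in (0 : ℝ)..1, (windowIntegral u ℓ t x - ℓ * u t x) = 0 := by
    have h1 : ∫ x in (0 : ℝ)..1, windowIntegral u ℓ t x = 0 := by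
      simp only [windowIntegral]
      rw [intervalIntegral_intervalIntegral_swap]
      · refine intervalIntegral.integral_zero_ae (Filter.Eventually.of_forall fun y _ => ?_)
        have h2 := (h.sol.periodic t ht.le).integral_sub_translate hc y
        rw [intervalIntegral.integral_sub (Continuous.intervalIntegrable (by fun_prop) _ _)
          (hc.intervalIntegrable _ _), h.sol.zero_mean t ht.le, sub_zero] at h2
        exact h2
      · have hcc : Continuous (Function.uncurry fun x y => u t (x + y)) :=
          hc.comp (f := fun q : ℝ × ℝ => q.1 + q.2) (by fun_prop)
        exact (hcc.continuousOn.integrableOn_compact (isCompact_uIcc.prod isCompact_uIcc)).mono_set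
          (prod_mono uIoc_subset_uIcc uIoc_subset_uIcc)
    rw [intervalIntegral.integral_sub (hw.intervalIntegrable _ _)
      (Continuous.intervalIntegrable (by fun_prop) _ _), h1, intervalIntegral.integral_const_mul,
      h.sol.zero_mean t ht.le]
    simp
  have hle : ∀ x, windowIntegral u ℓ t x - ℓ * u t x ≤ D * ℓ ^ 2 := by
    intro x
    have h1 : windowIntegral u ℓ t x - ℓ * u t x = ∫ y in (0 : ℝ)..ℓ, (u t (x + y) - u t x) := by
      rw [intervalIntegral.integral_sub (Continuous.intervalIntegrable (by fun_prop) _ _) (by simp)]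
      simp [windowIntegral]
    have h2 := intervalIntegral.integral_mono_on (μ := volume) hℓ.1 (f := fun y => u t (x + y) - u t x)
      (g := fun _ => D * ℓ) (Continuous.intervalIntegrable (by fun_prop) _ _)
      (continuous_const.intervalIntegrable _ _)
      fun y hy => (h.sub_le_D ht.le x ⟨hy.1, hy.2.trans hℓ.2⟩).trans
        (mul_le_mul_of_nonneg_left hy.2 hD.le)
    rw [h1]
    refine h2.trans (le_of_eq ?_)
    rw [intervalIntegral.integral_const, smul_eq_mul]
    ring
  have e : (∫ x in (0 : ℝ)..1, u t x * windowIntegral u ℓ t x) - ℓ * ∫ x in (0 : ℝ)..1, u t x ^ 2 =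
      ∫ x in (0 : ℝ)..1, u t x * (windowIntegral u ℓ t x - ℓ * u t x) := by
    rw [← intervalIntegral.integral_const_mul, ← intervalIntegral.integral_sub
      (Continuous.intervalIntegrable (by fun_prop) _ _)
      (Continuous.intervalIntegrable (by fun_prop) _ _)]
    refine intervalIntegral.integral_congr fun x _ => ?_
    ring
  rw [e]
  -- The window error has mean zero and is at most `D ℓ²`, so its `L¹` norm is at most `2D ℓ²`, by
  -- the same argument as for `u_x`.
  have h3 : |∫ x in (0 : ℝ)..1, u t x * (windowIntegral u ℓ t x - ℓ * u t x)| ≤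
      ∫ x in (0 : ℝ)..1, D * (2 * D * ℓ ^ 2 - (windowIntegral u ℓ t x - ℓ * u t x)) := by
    refine (intervalIntegral.abs_integral_le_integral_abs zero_le_one).trans ?_
    refine intervalIntegral.integral_mono_on zero_le_one
      (Continuous.intervalIntegrable (by fun_prop) _ _)
      (Continuous.intervalIntegrable (by fun_prop) _ _) fun x _ => ?_
    rw [abs_mul]
    refine mul_le_mul (h.abs_le_D ht.le x) ?_ (abs_nonneg _) hD.le
    have : 0 ≤ D * ℓ ^ 2 := by positivity
    rw [_root_.abs_le]
    constructor <;> linarith [hle x]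
  refine h3.trans (le_of_eq ?_)
  rw [intervalIntegral.integral_const_mul, intervalIntegral.integral_sub (by simp)
    (Continuous.intervalIntegrable (by fun_prop) _ _), hmean]
  simp
  ring

/-- With `a = u(x)` and `b = u(x + ℓ)`, the inviscid integrand `b f(a) - a f(b)` is `P(x + ℓ) -
P(x)` plus `(f(a) + f(b))(b - a) - 2 ∫_a^b f`. The first part integrates to zero and the second is
the trapezoidal error. The viscous part costs `ν D · 2 ∫ |u_x| ≤ 4D²ν`. -/
theorem correlation_deriv_ge (h : IsAdmissible f σ D M ν u) (ℓ : ℝ) {t : ℝ} (ht : 0 < t) :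
    -(2 * M * structureTwo (u t) ℓ + 4 * D ^ 2 * ν) ≤
      ∫ x in (0 : ℝ)..1, (u t x * viscousFlux f ν u t (x + ℓ) -
        viscousFlux f ν u t x * u t (x + ℓ)) := by
  have hD := h.D_pos
  have hν := h.nu_pos
  have hc := h.sol.continuous_slice ht.le
  have hdc := h.continuous_deriv ht
  have hfc := h.smooth_flux.continuous
  have hper := h.sol.periodic t ht.le
  have hdper := h.sol.periodic_deriv ht
  set P : ℝ → ℝ := fun x => 2 * (∫ z in (0 : ℝ)..(u t x), f z) - f (u t x) * u t x with hP
  have hprim : Continuous fun w : ℝ => ∫ z in (0 : ℝ)..w, f z :=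
    intervalIntegral.continuous_primitive (fun a b => hfc.intervalIntegrable a b) 0
  have hPc : Continuous P := by
    have := hprim.comp hc
    simp only [Function.comp_def] at this
    fun_prop
  have hPper : Function.Periodic P 1 := fun x => by simp only [hP, hper x]
  have hpt : ∀ x, (P (x + ℓ) - P x) - 2 * M * (u t (x + ℓ) - u t x) ^ 2 -
      ν * (D * (|deriv (u t) (x + ℓ)| + |deriv (u t) x|)) ≤
      u t x * viscousFlux f ν u t (x + ℓ) - viscousFlux f ν u t x * u t (x + ℓ) := by
    intro x
    have h1 := trapezoid_ge (h.smooth_flux.differentiable (by simp)) h.bound (h.abs_le_D ht.le x)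
      (h.abs_le_D ht.le (x + ℓ))
    rw [← intervalIntegral.integral_interval_sub_left (hfc.intervalIntegrable 0 _)
      (hfc.intervalIntegrable 0 _)] at h1
    have h2 : -(D * (|deriv (u t) (x + ℓ)| + |deriv (u t) x|)) ≤
        u t x * deriv (u t) (x + ℓ) - deriv (u t) x * u t (x + ℓ) := by
      have a1 : |u t x * deriv (u t) (x + ℓ)| ≤ D * |deriv (u t) (x + ℓ)| := by
        rw [abs_mul]
        exact mul_le_mul_of_nonneg_right (h.abs_le_D ht.le x) (abs_nonneg _)
      have a2 : |deriv (u t) x * u t (x + ℓ)| ≤ D * |deriv (u t) x| := by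
        rw [abs_mul, mul_comm]
        exact mul_le_mul_of_nonneg_right (h.abs_le_D ht.le _) (abs_nonneg _)
      linarith [neg_abs_le (u t x * deriv (u t) (x + ℓ)), le_abs_self (deriv (u t) x * u t (x + ℓ))]
    have h3 := mul_le_mul_of_nonneg_left h2 hν.le
    simp only [hP, viscousFlux]
    linarith
  have hvc : Continuous (viscousFlux f ν u t) :=
    IsBurgersSolution.continuous_slice_of_continuousOn
      (h.sol.continuousOn_viscousFlux h.smooth_flux) ht
  have h1 := intervalIntegral.integral_mono_on (μ := volume) (zero_le_one : (0 : ℝ) ≤ 1)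
    (Continuous.intervalIntegrable (by fun_prop) _ _)
    (Continuous.intervalIntegrable (by fun_prop) _ _) fun x _ => hpt x
  refine le_trans ?_ h1
  rw [intervalIntegral.integral_sub (Continuous.intervalIntegrable (by fun_prop) _ _)
    (Continuous.intervalIntegrable (by fun_prop) _ _),
    intervalIntegral.integral_sub (Continuous.intervalIntegrable (by fun_prop) _ _)
    (Continuous.intervalIntegrable (by fun_prop) _ _), hPper.integral_sub_translate hPc,
    intervalIntegral.integral_const_mul, intervalIntegral.integral_const_mul,
    intervalIntegral.integral_const_mul,
    intervalIntegral.integral_add (Continuous.intervalIntegrable (by fun_prop) _ _)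
    (Continuous.intervalIntegrable (by fun_prop) _ _)]
  have h2 : ∫ x in (0 : ℝ)..1, |deriv (u t) (x + ℓ)| = ∫ x in (0 : ℝ)..1, |deriv (u t) x| := by
    have hp : Function.Periodic (fun x => |deriv (u t) x|) 1 := fun x => by simp only [hdper x]
    have := hp.integral_sub_translate hdc.abs ℓ
    rw [intervalIntegral.integral_sub (Continuous.intervalIntegrable (by fun_prop) _ _)
      (Continuous.intervalIntegrable (by fun_prop) _ _)] at this
    linarith
  rw [h2]
  have h3 := mul_le_mul_of_nonneg_left (h.integral_abs_deriv_le ht) (mul_pos hν hD).le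
  simp only [structureTwo]
  linarith

theorem continuousOn_structureTwo (h : IsAdmissible f σ D M ν u) (ℓ : ℝ) :
    ContinuousOn (fun t => structureTwo (u t) ℓ) (Ioi 0) := by
  have hu := h.sol.continuousOn_pos
  have hu' : ContinuousOn (Function.uncurry fun t x => u t (x + ℓ)) (Ioi (0 : ℝ) ×ˢ univ) :=
    hu.comp (f := fun q : ℝ × ℝ => (q.1, q.2 + ℓ)) (by fun_prop) fun q hq => ⟨hq.1, mem_univ _⟩
  exact continuousOn_intervalIntegral (F := fun t x => (u t (x + ℓ) - u t x) ^ 2)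
    ((hu'.sub hu).fun_pow 2) 0 1

/-- In units of `ℓ D⁻²`, the energy drop contributes at least `1/2 - 1/4`, the correlation error
costs at most `1/8` and viscosity at most `1/16`; at least `1/16` is left for `2M ∫ S`. -/
theorem integral_structureTwo_ge (h : IsAdmissible f σ D M ν u) {Ct : ℝ}
    (hCt : IsH1Constant f D Ct) {T₁ T₂ : ℝ} (hT₁ : T₁ = startTime D Ct) (hT : T₁ ≤ T₂)
    (hT₂ : 2 * D * σ⁻¹ ≤ T₂) {ℓ : ℝ} (hℓ : 0 < ℓ) (hℓ1 : ℓ ≤ 1) (hℓD : 32 * D ^ 4 * ℓ ≤ 1)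
    (hℓν : 64 * D ^ 4 * (T₂ - T₁) * ν ≤ ℓ) :
    ℓ / (32 * D ^ 2 * M) ≤ ∫ t in T₁..T₂, structureTwo (u t) ℓ := by
  have hD := h.D_pos
  have hM : 0 < M := zero_lt_one.trans_le h.one_le_bound
  have hCt0 := hCt.1
  have hpos : 0 < T₁ := by rw [hT₁, startTime]; positivity
  set K : ℝ → ℝ := fun τ => ∫ x in (0 : ℝ)..1, u τ x * windowIntegral u ℓ τ x with hK
  have hder := fun τ (hτ : 0 < τ) => h.sol.hasDerivAt_correlation h.smooth_flux ℓ hτ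
  have hint : IntervalIntegrable (fun t => structureTwo (u t) ℓ) volume T₁ T₂ := by
    refine ContinuousOn.intervalIntegrable ((h.continuousOn_structureTwo ℓ).mono ?_)
    rw [uIcc_of_le hT]
    exact fun τ hτ => hpos.trans_le hτ.1
  have hint' : IntervalIntegrable (fun t => 2 * M * structureTwo (u t) ℓ + 4 * D ^ 2 * ν)
      volume T₁ T₂ := (hint.const_mul _).add (by simp)
  have h1 := intervalIntegral.sub_le_integral_of_hasDeriv_right_of_le hT (g := fun τ => -K τ)
    (φ := fun t => 2 * M * structureTwo (u t) ℓ + 4 * D ^ 2 * ν)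
    (fun τ hτ => (hder τ (hpos.trans_le hτ.1)).continuousAt.continuousWithinAt.neg)
    (fun τ hτ => (hder τ (hpos.trans hτ.1)).fun_neg.hasDerivWithinAt)
    ((intervalIntegrable_iff_integrableOn_Icc_of_le hT).1 hint')
    (fun τ hτ => by linarith [h.correlation_deriv_ge ℓ (hpos.trans hτ.1)])
  rw [intervalIntegral.integral_add (hint.const_mul _) (by simp),
    intervalIntegral.integral_const_mul, intervalIntegral.integral_const, smul_eq_mul] at h1
  have e1 := (_root_.abs_le.1 (h.abs_correlation_sub_le ⟨hℓ.le, hℓ1⟩ hpos)).1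
  have e2 := (_root_.abs_le.1 (h.abs_correlation_sub_le ⟨hℓ.le, hℓ1⟩ (hpos.trans_le hT))).2
  have g1 := h.energy_ge hCt hpos.le
  have g2 := h.energy_le hT₂
  have g3 : 2 * Ct * T₁ = (D ^ 2)⁻¹ / 2 := by
    rw [hT₁, startTime]; field_simp; norm_num
  rw [g3] at g1
  have g1' := mul_le_mul_of_nonneg_left g1 hℓ.le
  have g2' := mul_le_mul_of_nonneg_left g2 hℓ.le
  have k1 : 4 * D ^ 2 * ℓ ^ 2 ≤ ℓ * ((D ^ 2)⁻¹ / 8) := by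
    have : 4 * D ^ 2 * ℓ ^ 2 = ℓ * ((D ^ 2)⁻¹ / 8) * (32 * D ^ 4 * ℓ) := by field_simp; norm_num
    rw [this]
    exact mul_le_of_le_one_right (by positivity) hℓD
  have k2 : (T₂ - T₁) * (4 * D ^ 2 * ν) ≤ ℓ * ((D ^ 2)⁻¹ / 16) := by
    have : (T₂ - T₁) * (4 * D ^ 2 * ν) = (64 * D ^ 4 * (T₂ - T₁) * ν) * ((D ^ 2)⁻¹ / 16) := by
      field_simp; ring
    rw [this]
    exact mul_le_mul_of_nonneg_right hℓν (by positivity)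
  have k3 : ℓ * ((D ^ 2)⁻¹ / 16) ≤ 2 * M * ∫ t in T₁..T₂, structureTwo (u t) ℓ := by
    simp only [hK] at h1
    linarith
  have k4 : ℓ / (32 * D ^ 2 * M) = (ℓ * ((D ^ 2)⁻¹ / 16)) / (2 * M) := by field_simp; norm_num
  rw [k4, div_le_iff₀ (by positivity)]
  linarith

end IsAdmissible

/-! ### Time averages -/

theorem timeAverage_le {T₁ T₂ B : ℝ} (hT : T₁ < T₂) {A : ℝ → ENNReal}
    (hA : ∀ t ∈ Icc T₁ T₂, A t ≤ ENNReal.ofReal B) : timeAverage T₁ T₂ A ≤ ENNReal.ofReal B := by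
  have hL : 0 < T₂ - T₁ := sub_pos.2 hT
  rw [timeAverage]
  refine ENNReal.div_le_of_le_mul ?_
  calc ∫⁻ t in Icc T₁ T₂, A t ≤ ∫⁻ _ in Icc T₁ T₂, ENNReal.ofReal B :=
        setLIntegral_mono' measurableSet_Icc hA
    _ = _ := by simp

/-- The comparison may use only an initial subinterval `[T₁, T]`. Bounding `A` below through a
continuous `g` avoids any measurability of `A`. -/
theorem le_timeAverage {T₁ T T₂ κ b : ℝ} (hT : T₁ < T₂) (hT' : T₁ ≤ T) (hTT : T ≤ T₂) (hκ : 0 < κ)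
    {A : ℝ → ENNReal} {g : ℝ → ℝ} (hg : ContinuousOn g (Icc T₁ T)) (hg0 : ∀ t ∈ Icc T₁ T, 0 ≤ g t)
    (hA : ∀ t ∈ Icc T₁ T, ENNReal.ofReal (g t) ≤ ENNReal.ofReal κ * A t)
    (hb : b ≤ ∫ t in T₁..T, g t) :
    ENNReal.ofReal (b / (κ * (T₂ - T₁))) ≤ timeAverage T₁ T₂ A := by
  have hL : 0 < T₂ - T₁ := sub_pos.2 hT
  have h1 : ENNReal.ofReal b ≤ ENNReal.ofReal κ * ∫⁻ t in Icc T₁ T₂, A t := by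
    calc ENNReal.ofReal b ≤ ENNReal.ofReal (∫ t in Icc T₁ T, g t) := by
          refine ENNReal.ofReal_le_ofReal (hb.trans (le_of_eq ?_))
          rw [intervalIntegral.integral_of_le hT', integral_Icc_eq_integral_Ioc]
      _ = ∫⁻ t in Icc T₁ T, ENNReal.ofReal (g t) :=
          ofReal_integral_eq_lintegral_ofReal (hg.integrableOn_compact isCompact_Icc)
            ((ae_restrict_iff' measurableSet_Icc).2 (Filter.Eventually.of_forall hg0))
      _ ≤ ∫⁻ t in Icc T₁ T, ENNReal.ofReal κ * A t := setLIntegral_mono' measurableSet_Icc hA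
      _ = ENNReal.ofReal κ * ∫⁻ t in Icc T₁ T, A t :=
          lintegral_const_mul' _ _ ENNReal.ofReal_ne_top
      _ ≤ _ := by gcongr
  rw [timeAverage, ENNReal.le_div_iff_mul_le (by simp [hT]) (by simp), ← ENNReal.ofReal_mul' hL.le]
  have h2 : b / (κ * (T₂ - T₁)) * (T₂ - T₁) = κ⁻¹ * b := by field_simp
  rw [h2, ENNReal.ofReal_mul (inv_nonneg.2 hκ.le), ENNReal.ofReal_inv_of_pos hκ]
  rwa [ENNReal.inv_mul_le_iff (by simp [hκ]) (by simp)]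

/-- A lower bound for the time average of `‖u(t)‖_s²`. -/
def SobolevLowerBound (f : ℝ → ℝ) (σ D M Ct ν₀ s : ℝ) (Y : ℝ → ℝ) : Prop :=
  ∃ c : ℝ, 0 < c ∧ ∀ ν ∈ Ioc (0 : ℝ) ν₀, ∀ u : ℝ → ℝ → ℝ, IsAdmissible f σ D M ν u →
    ENNReal.ofReal (c * Y ν) ≤
      timeAverage (startTime D Ct) (endTime σ D Ct) (fun t => sobolevNormSq s (u t))

/-! ### Lower bounds for the averaged norms -/

section Lower

variable {f : ℝ → ℝ} {σ D M Ct : ℝ}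

theorem startTime_pos (hD : 0 < D) (hCt : 0 < Ct) : 0 < startTime D Ct := by
  rw [startTime]; positivity

theorem startTime_lt_endTime (hD : 0 < D) (hCt : 0 < Ct) : startTime D Ct < endTime σ D Ct :=
  lt_of_lt_of_le (by linarith [startTime_pos hD hCt]) (le_max_left _ _)

/-- On `[T₁, 3T₁/2]` at most three quarters of `D⁻²` has been dissipated, and every homogeneous norm
dominates the `L²` norm of a mean-zero function. The term `3T₁/2` in `T₂` places this interval
inside the averaging window. -/
theorem sobolevLowerBound_of_lt_half (ν₀ : ℝ) (hD : 0 < D) (hCt : IsH1Constant f D Ct) {s : ℝ}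
    (hs : 0 < s) : SobolevLowerBound f σ D M Ct ν₀ s fun _ => 1 := by
  have hCt0 := hCt.1
  have hT := startTime_pos hD hCt.1
  have hTT := startTime_lt_endTime (σ := σ) hD hCt.1
  have hL := sub_pos.2 hTT
  set T := startTime D Ct with hTdef
  refine ⟨(T / 2 * ((D ^ 2)⁻¹ / 4)) / (1 * (endTime σ D Ct - T)), by positivity,
    fun ν _ u hu => ?_⟩
  rw [mul_one]
  refine le_timeAverage (T := 3 / 2 * T) (g := fun _ => (D ^ 2)⁻¹ / 4) hTT (by linarith)
    (le_max_left _ _) one_pos continuousOn_const (fun t _ => by positivity) (fun t ht => ?_) ?_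
  · have ht0 : 0 < t := hT.trans_le ht.1
    rw [ENNReal.ofReal_one, one_mul]
    refine le_trans (ENNReal.ofReal_le_ofReal ?_) (integral_sq_le_sobolevNormSq hs.le
      (hu.sol.continuous_slice ht0.le) (hu.sol.zero_mean t ht0.le))
    refine le_trans ?_ (hu.energy_ge hCt ht0.le)
    have h1 : 2 * Ct * t ≤ 2 * Ct * (3 / 2 * T) := mul_le_mul_of_nonneg_left ht.2 (by positivity)
    have h2 : 2 * Ct * (3 / 2 * T) = 3 * ((D ^ 2)⁻¹ / 4) := by
      rw [hTdef, startTime]; field_simp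
    linarith
  · rw [intervalIntegral.integral_const, smul_eq_mul]
    refine le_of_eq ?_
    ring

theorem log_sub_log_le_sum_inv (a b : ℕ) :
    Real.log (b + 1) - Real.log a ≤ ∑ N ∈ Finset.Icc a b, (N : ℝ)⁻¹ := by
  induction b with
  | zero =>
    have h1 : 0 ≤ Real.log a := Real.log_natCast_nonneg a
    have h2 : 0 ≤ ∑ N ∈ Finset.Icc a 0, (N : ℝ)⁻¹ := Finset.sum_nonneg fun N _ => by positivity
    simp only [Nat.cast_zero, zero_add, Real.log_one]
    linarith
  | succ b ih =>
    rcases le_or_gt a (b + 1) with h | h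
    · rw [Finset.sum_Icc_succ_top h]
      have hb : (0 : ℝ) < (b : ℝ) + 1 := by positivity
      have h1 := Real.log_le_sub_one_of_pos (show 0 < ((b : ℝ) + 1 + 1) / (b + 1) by positivity)
      rw [Real.log_div (by positivity) hb.ne'] at h1
      have h2 : ((b : ℝ) + 1 + 1) / (b + 1) - 1 = ((b : ℝ) + 1)⁻¹ := by field_simp; ring
      push_cast
      linarith
    · have h1 : Real.log (((b + 1 : ℕ) : ℝ) + 1) ≤ Real.log a := by
        refine Real.log_le_log (by positivity) ?_
        exact_mod_cast h
      have h2 : 0 ≤ ∑ N ∈ Finset.Icc a (b + 1), (N : ℝ)⁻¹ :=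
        Finset.sum_nonneg fun N _ => by positivity
      linarith

/-- The range of scales on which the structure function is of order `ℓ`. -/
theorem exists_inertial_range (f : ℝ → ℝ) (σ : ℝ) (hD : 0 < D) (hM : 1 ≤ M)
    (hCt : IsH1Constant f D Ct) : ∃ c : ℝ, 0 < c ∧ ∃ K : ℝ, 1 ≤ K ∧ ∃ n : ℕ, 1 ≤ n ∧
      ∀ ν u, IsAdmissible f σ D M ν u → ∀ ℓ, K * ν ≤ ℓ → ℓ ≤ (n : ℝ)⁻¹ →
        c * ℓ ≤ ∫ t in (startTime D Ct)..(endTime σ D Ct), structureTwo (u t) ℓ := by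
  have hTT := startTime_lt_endTime (σ := σ) hD hCt.1
  refine ⟨1 / (32 * D ^ 2 * M), by positivity,
    -- The lower limit `K ν` makes viscosity negligible; the upper limit `1/n` controls the `O(ℓ²)`
    -- error of the correlation.
    max 1 (64 * D ^ 4 * (endTime σ D Ct - startTime D Ct)), le_max_left _ _,
    ⌈32 * D ^ 4⌉₊, Nat.one_le_ceil_iff.2 (by positivity), fun ν u hu ℓ hℓ1 hℓ2 => ?_⟩
  have hν := hu.nu_pos
  have hℓ : 0 < ℓ := lt_of_lt_of_le (by positivity) hℓ1
  have hn1 : (1 : ℝ) ≤ ⌈32 * D ^ 4⌉₊ := by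
    exact_mod_cast Nat.one_le_ceil_iff.2 (show 0 < 32 * D ^ 4 by positivity)
  have hn2 := Nat.le_ceil (32 * D ^ 4)
  have h1 := hu.integral_structureTwo_ge hCt rfl hTT.le (le_max_right _ _) hℓ
    (hℓ2.trans (inv_le_one_of_one_le₀ hn1)) (by
      calc 32 * D ^ 4 * ℓ ≤ (⌈32 * D ^ 4⌉₊ : ℝ) * (⌈32 * D ^ 4⌉₊ : ℝ)⁻¹ := by gcongr
        _ = 1 := mul_inv_cancel₀ (by positivity))
    ((mul_le_mul_of_nonneg_right (le_max_right _ _) hν.le).trans hℓ1)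
  rwa [div_mul_eq_mul_div, one_mul]

theorem exists_sobolevLowerBound (f : ℝ → ℝ) (σ : ℝ) (hD : 0 < D) (hM : 1 ≤ M)
    (hCt : IsH1Constant f D Ct) : ∃ ν₀ : ℝ, 0 < ν₀ ∧ ν₀ ≤ 1 / 4 ∧
      SobolevLowerBound f σ D M Ct ν₀ (1 / 2) (fun ν => |Real.log ν|) ∧
      ∀ s ∈ Ioo (1 / 2 : ℝ) 1, SobolevLowerBound f σ D M Ct ν₀ s fun ν => ν ^ (-(2 * s - 1)) := by
  obtain ⟨c, hc, K, hK, n, hn, hrange⟩ := exists_inertial_range f σ hD hM hCt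
  have hT := startTime_pos hD hCt.1
  have hTT := startTime_lt_endTime (σ := σ) hD hCt.1
  have hL := sub_pos.2 hTT
  have hn' : (1 : ℝ) ≤ n := by exact_mod_cast hn
  have hcont : ∀ {ν u}, IsAdmissible f σ D M ν u → ∀ ℓ, ContinuousOn
      (fun t => structureTwo (u t) ℓ) (Icc (startTime D Ct) (endTime σ D Ct)) := fun hu ℓ =>
    (hu.continuousOn_structureTwo ℓ).mono fun t ht => hT.trans_le ht.1
  -- With `ν ≤ (K n)⁻²` the inertial range is nonempty and `log (1 / (K ν)) - log n ≥ |log ν| / 2`.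
  refine ⟨min (1 / 4) ((K * n) ^ 2)⁻¹, by positivity, min_le_left _ _,
    ⟨c / 2 / (8 * Real.pi ^ 2 * (endTime σ D Ct - startTime D Ct)), by positivity,
      fun ν hν u hu => ?_⟩,
    fun s hs => ⟨c / (4 * Real.pi ^ 2 * (endTime σ D Ct - startTime D Ct)) * K ^ (-(2 * s - 1)),
      by positivity, fun ν hν u hu => ?_⟩⟩
  · have hνpos := hν.1
    have hν1 := hν.2.trans (min_le_right _ _)
    have hlog := one_le_neg_log ⟨hν.1, hν.2.trans (min_le_left _ _)⟩
    -- The largest `N` whose scale `1/N` is still at least `K ν`.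
    set b : ℕ := ⌊(K * ν)⁻¹⌋₊ with hb
    have hint : ∀ N ∈ Finset.Icc n b, IntervalIntegrable
        (fun t => structureTwo (u t) (N : ℝ)⁻¹) volume (startTime D Ct) (endTime σ D Ct) := by
      intro N _
      refine ContinuousOn.intervalIntegrable ?_
      rw [uIcc_of_le hTT.le]
      exact hcont hu _
    have hsum : c * ∑ N ∈ Finset.Icc n b, (N : ℝ)⁻¹ ≤
        ∫ t in (startTime D Ct)..(endTime σ D Ct),
          ∑ N ∈ Finset.Icc n b, structureTwo (u t) (N : ℝ)⁻¹ := by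
      rw [intervalIntegral.integral_finsetSum hint, Finset.mul_sum]
      refine Finset.sum_le_sum fun N hN => ?_
      obtain ⟨hN1, hN2⟩ := Finset.mem_Icc.1 hN
      have hN0 : (0 : ℝ) < N := by exact_mod_cast hn.trans hN1
      refine hrange ν u hu _ ?_ ?_
      · rw [le_inv_comm₀ (by positivity) hN0]
        exact (Nat.le_floor_iff (by positivity)).1 hN2
      · exact inv_anti₀ (by positivity) (by exact_mod_cast hN1)
    have hlower : 1 / 2 * |Real.log ν| ≤ ∑ N ∈ Finset.Icc n b, (N : ℝ)⁻¹ := by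
      refine le_trans ?_ (log_sub_log_le_sum_inv n b)
      have h1 : Real.log (K * ν)⁻¹ ≤ Real.log (b + 1) :=
        Real.log_le_log (by positivity) (Nat.lt_floor_add_one _).le
      have h2 : Real.log ν ≤ Real.log ((K * n) ^ 2)⁻¹ := Real.log_le_log hνpos hν1
      rw [Real.log_inv, Real.log_mul (by positivity) hνpos.ne'] at h1
      rw [Real.log_inv, Real.log_pow, Real.log_mul (by positivity) (by positivity)] at h2
      rw [abs_of_neg (by linarith)]
      push_cast at h2
      linarith
    have h1 := le_timeAverage (b := c * (1 / 2 * |Real.log ν|)) hTT hTT.le le_rfl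
      (show 0 < 8 * Real.pi ^ 2 by positivity)
      (A := fun t => sobolevNormSq (1 / 2) (u t))
      (g := fun t => ∑ N ∈ Finset.Icc n b, structureTwo (u t) (N : ℝ)⁻¹)
      (continuousOn_finsetSum _ fun N _ => hcont hu _)
      (fun t _ => Finset.sum_nonneg fun N _ => structureTwo_nonneg _ _)
      (fun t ht => sum_structureTwo_le_sobolevNormSq
        (hu.sol.continuous_slice (hT.le.trans ht.1)) (hu.sol.periodic t (hT.le.trans ht.1)) hn b)
      ((mul_le_mul_of_nonneg_left hlower hc.le).trans hsum)
    refine le_trans (le_of_eq ?_) h1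
    congr 1
    ring
  · have hνpos := hν.1
    have hKν : K * ν ≤ (n : ℝ)⁻¹ := by
      have h1 := mul_le_mul_of_nonneg_left (hν.2.trans (min_le_right _ _)) (show 0 ≤ K by linarith)
      refine h1.trans ?_
      have h2 : K * ((K * n) ^ 2)⁻¹ = (n : ℝ)⁻¹ * (K * n)⁻¹ := by field_simp
      rw [h2]
      exact mul_le_of_le_one_right (by positivity)
        (inv_le_one_of_one_le₀ (one_le_mul_of_one_le_of_one_le hK hn'))
    have hKν0 : 0 < K * ν := by positivity
    -- The smallest admissible scale is the best one here: the bound `ℓ / ℓ^(2s)` grows as `ℓ`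
    -- decreases when `s > 1/2`.
    have h1 := le_timeAverage (b := c * (K * ν)) hTT hTT.le le_rfl
      (show 0 < 4 * Real.pi ^ 2 * (K * ν) ^ (2 * s) by positivity)
      (A := fun t => sobolevNormSq s (u t)) (g := fun t => structureTwo (u t) (K * ν))
      (hcont hu _) (fun t _ => structureTwo_nonneg _ _)
      (fun t ht => structureTwo_le_sobolevNormSq (by linarith [hs.1]) hs.2.le
        (hu.sol.continuous_slice (hT.le.trans ht.1)) (hu.sol.periodic t (hT.le.trans ht.1))
        hKν0.le)
      (hrange ν u hu _ le_rfl hKν)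
    refine le_trans (le_of_eq ?_) h1
    congr 1
    have h2 : K ^ (-(2 * s - 1)) * ν ^ (-(2 * s - 1)) = (K * ν) / (K * ν) ^ (2 * s) := by
      rw [← Real.mul_rpow (by linarith) hνpos.le, show -(2 * s - 1) = 1 - 2 * s by ring,
        Real.rpow_sub hKν0, Real.rpow_one]
    rw [mul_assoc, h2]
    field_simp

end Lower

/-! ### Assembly of the two-sided estimates -/

theorem sobolevAverageSim_of_bounds {f : ℝ → ℝ} (hf : ContDiff ℝ ∞ f) {σ : ℝ} (hσ : 0 < σ)
    (hconv : ∀ x : ℝ, σ ≤ deriv (deriv f) x) {D M Ct ν₀ s : ℝ} (hD : 0 < D) (hM : 1 ≤ M)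
    (hbound : ∀ x ∈ Icc (-D) D, |deriv f x| ≤ M) (hCt : 0 < Ct) (hν₀ : ν₀ ≤ 1) {Y : ℝ → ℝ}
    (hY : ∀ ν ∈ Ioc (0 : ℝ) ν₀, 0 ≤ Y ν) (hup : SobolevUpperBound f σ D M ν₀ s Y)
    (hlow : SobolevLowerBound f σ D M Ct ν₀ s Y) : SobolevAverageSim f σ D Ct ν₀ s Y := by
  obtain ⟨C, hC, hup⟩ := hup
  obtain ⟨c, hc, hlow⟩ := hlow
  have hT := startTime_pos hD hCt
  have hTT := startTime_lt_endTime (σ := σ) hD hCt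
  refine ⟨max C c⁻¹, by positivity, fun ν hν u hu hDu => ?_⟩
  have hadm : IsAdmissible f σ D M ν u :=
    ⟨hf, hσ, hconv, hbound, hM, ⟨hν.1, hν.2.trans hν₀⟩, hu, hDu⟩
  constructor
  · refine le_trans (ENNReal.ofReal_le_ofReal ?_) (hlow ν hν u hadm)
    refine mul_le_mul_of_nonneg_right ?_ (hY ν hν)
    exact inv_le_of_inv_le₀ hc (le_max_right _ _)
  · refine (timeAverage_le hTT fun t ht => hup ν hν u hadm t (hT.trans_le ht.1)).trans
      (ENNReal.ofReal_le_ofReal ?_)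
    exact mul_le_mul_of_nonneg_right (le_max_left _ _) (hY ν hν)

/-- Vacuous: the `D` of any solution is positive. -/
theorem sobolevAverageSim_of_nonpos {f : ℝ → ℝ} {σ D Ct ν₀ s : ℝ} {Y : ℝ → ℝ} (hD : D ≤ 0) :
    SobolevAverageSim f σ D Ct ν₀ s Y :=
  ⟨1, one_pos, fun _ _ _ hu hDu =>
    absurd (pos_of_initialD_eq (hu.continuous_slice le_rfl) hDu) hD.not_gt⟩

theorem mainTheorem4 (f : ℝ → ℝ) (hf : ContDiff ℝ ∞ f)
    (σ : ℝ) (hσ : 0 < σ) (hconv : ∀ x : ℝ, σ ≤ deriv (deriv f) x) (D : ℝ) :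
    (∃ Ct : ℝ, IsH1Constant f D Ct) ∧
    ∀ Ct : ℝ, IsH1Constant f D Ct →
      ∃ ν₀ : ℝ, 0 < ν₀ ∧ ν₀ < 1 ∧
        (∀ s ∈ Set.Ioo (0 : ℝ) (1 / 2), SobolevAverageSim f σ D Ct ν₀ s (fun _ => 1)) ∧
        SobolevAverageSim f σ D Ct ν₀ (1 / 2) (fun ν => |Real.log ν|) ∧
        (∀ s ∈ Set.Ioo (1 / 2 : ℝ) 1,
          SobolevAverageSim f σ D Ct ν₀ s (fun ν => ν ^ (-(2 * s - 1)))) := by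
  refine ⟨exists_isH1Constant hf hσ hconv D, fun Ct hCt => ?_⟩
  rcases le_or_gt D 0 with hD | hD
  · exact ⟨1 / 2, by norm_num, by norm_num, fun s _ => sobolevAverageSim_of_nonpos hD,
      sobolevAverageSim_of_nonpos hD, fun s _ => sobolevAverageSim_of_nonpos hD⟩
  obtain ⟨M, hM, hbound⟩ := exists_bound_deriv hf D
  obtain ⟨ν₀, hν₀, hν₀', hhalf, hlarge⟩ := exists_sobolevLowerBound f σ hD hM hCt
  have hone : ν₀ ≤ 1 := by linarith
  refine ⟨ν₀, hν₀, by linarith, fun s hs => ?_, ?_, fun s hs => ?_⟩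
  · exact sobolevAverageSim_of_bounds hf hσ hconv hD hM hbound hCt.1 hone
      (fun _ _ => zero_le_one) (sobolevUpperBound_of_lt_half f σ D M ν₀ hs.1 hs.2)
      (sobolevLowerBound_of_lt_half ν₀ hD hCt hs.1)
  · exact sobolevAverageSim_of_bounds hf hσ hconv hD hM hbound hCt.1 hone
      (fun _ _ => abs_nonneg _) (sobolevUpperBound_half f σ hD hM hν₀') hhalf
  · exact sobolevAverageSim_of_bounds hf hσ hconv hD hM hbound hCt.1 hone
      (fun ν hν => Real.rpow_nonneg hν.1.le _)
      (sobolevUpperBound_of_half_lt f σ ν₀ hD hM hs.1 hs.2) (hlarge s hs)
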